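/- Let $G=SU(2)$ with a (not necessarily normalized) Haar measure $dg$ of volume $V_G$, let $\chi_j$ be the character of the spin-$j$ representation ($j\in\{0,\tfrac12,1,\dots\}$), $d_j=2j+1$, and $h_\varphi=\mathrm{diag}(e^{i\varphi},e^{-i\varphi})$. Let $\Delta$ be a triangulation with finitely many edges $e$ and dual edges $e^*$ (more generally, any finite set of edges, each with a finite word in finitely many dual edges). For $g=(g_{e^*})$ in $G$ let $G_e$ be the ordered product of the $g_{e^*}^{\pm1}$ around the dual face of $e$. The expectation value of an observable $\mathcal O(j_e,g_{e^*})$ is $$\langle\mathcal O\rangle=\sum_{\{j_e\}}\ \prod_{e}\frac{d_{j_e}}{V_G}\int\prod_{e^*}dg_{e^*}\ \prod_e\chi_{j_e}(G_e)\ \mathcal O(j_e,g_{e^*}).$$ Let $\Gamma$ be a set of edges of $\Delta$, and put $$\mathcal O_{\Gamma,j^\Gamma}=\prod_{e\in\Gamma}\frac{\delta_{j_e,j_e^\Gamma}}{d_{j_e^\Gamma}},\qquad \tilde{\mathcal O}_{\Gamma,\varphi}=\prod_{e\in\Gamma}\delta_{j_e,0}\,\delta_{\varphi_e}(G_e),\qquad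 \Delta(\varphi)=\prod_{e\in\Gamma}\sin\varphi_e .$$ Here $\delta_\varphi$ is the distribution on $G$ given by $\int_G\delta_\varphi(g)f(g)\,dg=\int_{G/H}f(xh_\varphi x^{-1})\,dx$, where $H$ is the diagonal subgroup and the invariant measure $dx$ on $G/H$ is normalized by $\int_Gf\,dg=\frac12\int_0^{2\pi}\sin^2\theta\,\int_{G/H}f(xh_\theta x^{-1})\,dx\,d\theta$ (so its total mass is $\tfrac2\pi V_G$). Let a test function be a smooth function $h:\mathbb R^\Gamma\to\mathbb C$ that is odd and $2\pi$-periodic in each variable. For every test function $h$, the function $D_h=\int_{[0,\pi]^\Gamma}d\varphi\;h(\varphi)\,\Delta(\varphi)\prod_{e\in\Gamma}\delta_{\varphi_e}(\cdot)$ is well defined: there is exactly one continuous function on $G^\Gamma$ which is the density, with respect to Haar measure, of the integral of the measures $\bigotimes_{e\in\Gamma}\delta_{\varphi_e}$ against $h(\varphi)\Delta(\varphi)\,d\varphi$ on $[0,\pi]^\Gamma$. So $\Delta(\varphi)\tilde{\mathcal O}_{\Gamma,\varphi}$ is a distribution in $\varphi$, and $$\int_{[0,\pi]^\Gamma}d\varphi\;h(\varphi)\,\Delta(\varphi)\,\langle\tilde{\mathcal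 O}_{\Gamma,\varphi}\rangle:=\Big\langle\prod_{e\in\Gamma}\delta_{j_e,0}\;D_h\big((G_e)_{e\in\Gamma}\big)\Big\rangle .$$ Convergence of a sum over spins means unconditional convergence. Then the following hold. 1. For all spins $j^\Gamma=(j^\Gamma_e)_{e\in\Gamma}$, $$\langle\mathcal O_{\Gamma,j^\Gamma}\rangle=\int_{[0,\pi]^\Gamma}\prod_{e\in\Gamma}d\varphi_e\,\sin\big[(2j_e^\Gamma+1)\varphi_e\big]\;\Delta(\varphi)\,\langle\tilde{\mathcal O}_{\Gamma,\varphi}\rangle ,$$ in the sense that the sum over spins that defines one side converges if and only if the one that defines the other side does, and the values then agree. 2. Suppose that $\Delta(\varphi)\langle\tilde{\mathcal O}_{\Gamma,\varphi}\rangle$ exists as a distribution, i.e. the sum over spins that defines its value on $h$ converges for every test function $h$. Then all $\langle\mathcal O_{\Gamma,j^\Gamma}\rangle$ exist (their sums over spins converge), and $$\Delta(\varphi)\,\langle\tilde{\mathcal O}_{\Gamma,\varphi}\rangle=\Big(\frac2\pi\Big)^{|\Gamma|}\sum_{\{j_e^\Gamma\}}\ \prod_{e\in\Gamma}\sin\big[(2j_e^\Gamma+1)\varphi_e\big]\;\langle\mathcal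 O_{\Gamma,j^\Gamma}\rangle$$ as distributions: for every test function $h$, the integrals of the summands on the right against $h$ over $[0,\pi]^\Gamma$ form an unconditionally convergent series whose sum is the value of the left side on $h$. -/

import Mathlib

open MeasureTheory
open scoped ContDiff

/-! ## The group `SU(2)` and its representations -/

/-- The group `SU(2)`, with the topology of `2 × 2` complex matrices. -/
abbrev SU2 : Type := Matrix.specialUnitaryGroup (Fin 2) ℂ

noncomputable instance SU2.instMeasurableSpace : MeasurableSpace SU2 := borel SU2

instance SU2.instBorelSpace : BorelSpace SU2 := ⟨rfl⟩

/-- The spin `j ∈ {0, 1/2, 1, 3/2, …}` is recorded by the natural number `n = 2 j`. -/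
abbrev TwiceSpin : Type := ℕ

/-- The dimension `d_j = 2 j + 1` of the spin `j` representation. -/
def spinDim (n : TwiceSpin) : ℕ := n + 1

/-- The action of a `2 × 2` matrix on polynomials in two variables by linear substitution
`X_k ↦ ∑ i, g i k • X_i`. -/
noncomputable def substHom (g : Matrix (Fin 2) (Fin 2) ℂ) :
    MvPolynomial (Fin 2) ℂ →ₐ[ℂ] MvPolynomial (Fin 2) ℂ :=
  MvPolynomial.aeval fun k => ∑ i, MvPolynomial.C (g i k) * MvPolynomial.X i

theorem substHom_one : substHom 1 = AlgHom.id ℂ _ := by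
  apply MvPolynomial.algHom_ext
  intro k
  fin_cases k <;> simp [substHom]

theorem substHom_mul (g h : Matrix (Fin 2) (Fin 2) ℂ) :
    substHom (g * h) = (substHom g).comp (substHom h) := by
  apply MvPolynomial.algHom_ext
  intro k
  simp [substHom, Matrix.mul_apply, MvPolynomial.algHom_C]
  ring

theorem substHom_mem (g : Matrix (Fin 2) (Fin 2) ℂ) (n : ℕ) :
    ∀ p ∈ MvPolynomial.homogeneousSubmodule (Fin 2) ℂ n,
      (substHom g).toLinearMap p ∈ MvPolynomial.homogeneousSubmodule (Fin 2) ℂ n := by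
  intro p hp
  have h := MvPolynomial.IsHomogeneous.aeval (n := 1)
    ((MvPolynomial.mem_homogeneousSubmodule n p).1 hp)
    (fun k : Fin 2 => ∑ i : Fin 2, MvPolynomial.C (g i k) * MvPolynomial.X i)
    (fun k => MvPolynomial.IsHomogeneous.sum _ _ _ fun i _ =>
      MvPolynomial.isHomogeneous_C_mul_X (g i k) i)
  rw [one_mul] at h
  exact (MvPolynomial.mem_homogeneousSubmodule n _).2 h

/-- The spin `j = n / 2` representation of `SU(2)`: the natural action on the space `V_j` of
homogeneous polynomials of degree `2 j` in two variables. -/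
noncomputable def spinRep (n : TwiceSpin) :
    Representation ℂ SU2 (MvPolynomial.homogeneousSubmodule (Fin 2) ℂ n) where
  toFun g := (substHom g.1).toLinearMap.restrict (substHom_mem g.1 n)
  map_one' := by
    ext p
    simp [substHom_one]
  map_mul' g h := by
    ext p
    simp [substHom_mul]

/-- The character `χ_j(g) = tr_{V_j} D_j(g)`. -/
noncomputable def spinChar (n : TwiceSpin) (g : SU2) : ℂ := (spinRep n).character g

/-- The element `h_φ = diag (e^{iφ}, e^{-iφ})` of the Cartan subgroup `H = U(1)`. -/
noncomputable def cartan (φ : ℝ) : SU2 :=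
  ⟨!![Complex.exp (φ * Complex.I), 0; 0, Complex.exp (-(φ * Complex.I))], by
    rw [Matrix.mem_specialUnitaryGroup_iff, Matrix.mem_unitaryGroup_iff]
    constructor
    · ext i j
      fin_cases i <;> fin_cases j <;>
        simp [Matrix.mul_apply, Matrix.star_apply, ← Complex.exp_conj, ← Complex.exp_add]
    · simp [Matrix.det_fin_two, ← Complex.exp_add]⟩

/-- The distribution `δ_φ(g) dg` that forces `g` to be conjugate to `h_φ`, namely the measure
`f ↦ ∫_{G/H} f (x h_φ x⁻¹) dx` on `G = SU(2)`. Here `dx` is the invariant measure on `G/H` for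
which Weyl's formula
`∫_G f dg = (1/2) ∫_0^{2π} sin² θ (∫_{G/H} f (x h_θ x⁻¹) dx) dθ` holds, so (take `f = 1`) its total
mass is `(2/π) V_G`, and it is the image of `(2/π) dg` on `G/H`. -/
noncomputable def conjDelta (μ : Measure SU2) (φ : ℝ) : Measure SU2 :=
  ENNReal.ofReal (2 / Real.pi) • μ.map fun x => x * cartan φ * x⁻¹

/-! ## Triangulations, dual skeleta and holonomies -/

/-- The dual two-skeleton `Δ*` of a cell decomposition: `E` is the set of edges `e`
(equivalently, of dual faces), `F` the set of oriented dual edges `e*`, and `loop e` lists the dual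
edges around the dual face of `e`, in the order in which its boundary is run through from the
chosen starting point, each with its relative orientation `ε(e, e*)` (`true` for `+1` and `false`
for `-1`). A dual edge may occur several times.
The dual skeleton of a triangulated three-manifold is `Triangulation.dualSkeleton` below. -/
structure DualSkeleton (E F : Type*) where
  loop : E → List (F × Bool)

/-- The holonomy `G_e`, the path-ordered product of the `g_{e*}^{ε(e, e*)}` around the dual face
of `e`, with later factors to the left. -/
noncomputable def DualSkeleton.holonomy {E F : Type*} (K : DualSkeleton E F) (g : F → SU2) (e : E) : SU2 :=
  ((K.loop e).map fun s => if s.2 then g s.1 else (g s.1)⁻¹).reverse.prod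

/-- A gluing of finitely many tetrahedra (with vertices numbered by `Fin 4`; the side `i` of a
tetrahedron is the triangle opposite to its vertex `i`) along all their sides, with the choices
that the Ponzano-Regge variables need. Every closed triangulated three-manifold is of this kind
(that vertex links are spheres is not imposed). -/
structure Triangulation where
  Tet : Type
  [fintypeTet : Fintype Tet]
  /-- the tetrahedron on the other side of the side `i` of `t` -/
  nbr : Tet → Fin 4 → Tet
  /-- how the side `i` is glued: the vertex `k ≠ i` of `t` becomes the vertex `glue t i k` of
  `nbr t i`, and `glue t i i` is the side of `nbr t i` that the side `i` is glued to -/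
  glue : Tet → Fin 4 → Equiv.Perm (Fin 4)
  nbr_nbr : ∀ t i, nbr (nbr t i) (glue t i i) = t
  glue_glue : ∀ t i, glue (nbr t i) (glue t i i) = (glue t i)⁻¹
  /-- the orientation of the dual edges: the two sides of a triangle are its source side, where
  `source` holds, and its target side -/
  source : Tet → Fin 4 → Bool
  source_flip : ∀ t i, source (nbr t i) (glue t i i) = !source t i
  /-- the edges of the triangulation -/
  Edge : Type
  /-- for each edge an orientation, a starting tetrahedron and a sense of rotation: the flag
  `(t, p)` stands for the edge of `t` from `p 0` to `p 1`, about to be turned around through the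
  side `p 2` of `t` -/
  start : Edge → Tet × Equiv.Perm (Fin 4)
  /-- `start` picks one flag from every edge, where two flags belong to the same edge if they are
  linked by changes of orientation, of the sense of rotation, and of tetrahedron -/
  start_unique : ∀ x, ∃! e, Relation.EqvGen
    (fun y z : Tet × Equiv.Perm (Fin 4) =>
      z = (y.1, y.2 * Equiv.swap 0 1) ∨ z = (y.1, y.2 * Equiv.swap 2 3) ∨
        z = (nbr y.1 (y.2 2), glue y.1 (y.2 2) * y.2 * Equiv.swap 2 3)) (start e) x
  /-- no edge is glued to itself with the opposite orientation -/
  no_flip : ∀ (x : Tet × Equiv.Perm (Fin 4)) (m : ℕ),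
    (fun y : Tet × Equiv.Perm (Fin 4) =>
      (nbr y.1 (y.2 2), glue y.1 (y.2 2) * y.2 * Equiv.swap 2 3))^[m] x
        ≠ (x.1, x.2 * Equiv.swap 0 1)

namespace Triangulation

variable (D : Triangulation)

/-- The dual edges `e*`, one for each triangle, given by its source side. -/
def DualEdge : Type := {s : D.Tet × Fin 4 // D.source s.1 s.2 = true}

/-- Turning around an edge, from a tetrahedron to the next one. -/
def step (y : D.Tet × Equiv.Perm (Fin 4)) : D.Tet × Equiv.Perm (Fin 4) :=
  (D.nbr y.1 (y.2 2), D.glue y.1 (y.2 2) * y.2 * Equiv.swap 2 3)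

/-- The dual edge along which one leaves the tetrahedron `t` through the side `i`, and whether one
follows its orientation. -/
def crossing (t : D.Tet) (i : Fin 4) : D.DualEdge × Bool :=
  if h : D.source t i = true then (⟨(t, i), h⟩, true)
  else (⟨(D.nbr t i, D.glue t i i), by
    have := D.source_flip t i
    simp_all⟩, false)

/-- The dual two-skeleton of a triangulation: around the edge `e` one turns from its starting
flag until that flag comes back. -/
noncomputable def dualSkeleton : DualSkeleton D.Edge D.DualEdge where
  loop e := (List.range (Function.minimalPeriod D.step (D.start e))).map fun m =>
    D.crossing (D.step^[m] (D.start e)).1 ((D.step^[m] (D.start e)).2 2)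

end Triangulation

/-! ## Observables and expectation values -/

section Observables

variable {E F : Type*} [Fintype E] [DecidableEq E] [Fintype F]

/-- The volume `V_G` of the group for the Haar measure `μ`. -/
noncomputable def groupVol (μ : Measure SU2) : ℂ := (μ.real Set.univ : ℂ)

/-- `Z_Δ(j, g) = ∏_e χ_{j_e}(G_e)`. -/
noncomputable def amplitude (K : DualSkeleton E F) (j : E → TwiceSpin) (g : F → SU2) : ℂ :=
  ∏ e, spinChar (j e) (K.holonomy g e)

/-- The summand of the expectation value of the observable `O` that belongs to the spins `j`:
`∏_e (d_{j_e} / V_G) ∫ ∏_{e*} dg_{e*} Z_Δ(j, g) O(j, g)`. -/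
noncomputable def expectationTerm (μ : Measure SU2) (K : DualSkeleton E F)
    (O : (E → TwiceSpin) → (F → SU2) → ℂ) (j : E → TwiceSpin) : ℂ :=
  (∏ e, (spinDim (j e) : ℂ) / groupVol μ) *
    ∫ g, amplitude K j g * O j g ∂(Measure.pi fun _ : F => μ)

/-- The expectation value `⟨O⟩_Δ` of a Ponzano-Regge observable `O(j, g)`. -/
noncomputable def expectation (μ : Measure SU2) (K : DualSkeleton E F)
    (O : (E → TwiceSpin) → (F → SU2) → ℂ) : ℂ :=
  ∑' j : E → TwiceSpin, expectationTerm μ K O j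

/-- The length-fixing observable `O_{Γ, j^Γ} = ∏_{e ∈ Γ} δ_{j_e, j_e^Γ} / d_{j_e^Γ}`. -/
noncomputable def lengthObs (F : Type*) (Γ : Finset E) (jΓ : Γ → TwiceSpin) :
    (E → TwiceSpin) → (F → SU2) → ℂ :=
  fun j _ => ∏ e : Γ, (if j e = jΓ e then 1 else 0) / (spinDim (jΓ e) : ℂ)

/-- `D` is the function `∫_{[0,π]^Γ} f(φ) ∏_{e ∈ Γ} δ_{φ_e}(G_e) dφ` of `(G_e)_{e ∈ Γ}`:
the continuous density, with respect to Haar measure, of the integral of the measures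
`⨂_{e ∈ Γ} δ_{φ_e}` against `f(φ) dφ` (where `[0, π] = H/W` labels the conjugacy classes). -/
def IsSmearedDelta {ι : Type*} [Fintype ι] (μ : Measure SU2) (f : (ι → ℝ) → ℂ)
    (D : (ι → SU2) → ℂ) : Prop :=
  Continuous D ∧ ∀ ψ : C(ι → SU2, ℂ),
    ∫ G, D G * ψ G ∂(Measure.pi fun _ : ι => μ) =
      ∫ φ in Set.univ.pi fun _ : ι => Set.Icc 0 Real.pi,
        f φ * ∫ G, ψ G ∂(Measure.pi fun e : ι => conjDelta μ (φ e))

open Classical in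
/-- The function of `IsSmearedDelta` (`0` if there is none). -/
noncomputable def smearedDelta {ι : Type*} [Fintype ι] (μ : Measure SU2) (f : (ι → ℝ) → ℂ) :
    (ι → SU2) → ℂ :=
  if h : ∃ D, IsSmearedDelta μ f D then h.choose else 0

/-- The particle observable `Õ_{Γ, φ} = ∏_{e ∈ Γ} δ_{j_e, 0} δ_{φ_e}(G_e)`, which is a
distribution in the angles `φ`, evaluated on `f`: the observable `∫_{[0,π]^Γ} f(φ) Õ_{Γ, φ} dφ`. -/
noncomputable def particleObs (μ : Measure SU2) (K : DualSkeleton E F) (Γ : Finset E)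
    (f : (Γ → ℝ) → ℂ) : (E → TwiceSpin) → (F → SU2) → ℂ :=
  fun j g => (∏ e : Γ, if j e = 0 then 1 else 0) *
    smearedDelta μ f fun e : Γ => K.holonomy g e

end Observables

/-! ## Sine transform -/

section SineTransform

variable {ι : Type*} [Fintype ι]

/-- `Δ(φ) = ∏_e sin φ_e`. -/
noncomputable def weylDelta (φ : ι → ℝ) : ℂ := ∏ e, (Real.sin (φ e) : ℂ)

/-- `∏_e sin ((2 j_e + 1) φ_e)`. -/
noncomputable def sineKernel (j : ι → TwiceSpin) (φ : ι → ℝ) : ℂ :=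
  ∏ e, (Real.sin ((spinDim (j e) : ℝ) * φ e) : ℂ)

/-- The test functions of the sine transform: smooth functions of the angles that are odd and
`2π`-periodic in every angle. They restrict to functions on `[0, π]^ι`, among which are all smooth
functions with compact support in `(0, π)^ι` and all `sineKernel j`. -/
structure IsSineTest [DecidableEq ι] (h : (ι → ℝ) → ℂ) : Prop where
  smooth : ContDiff ℝ ∞ h
  odd : ∀ φ e, h (Function.update φ e (-φ e)) = -h φ
  periodic : ∀ φ e, h (Function.update φ e (φ e + 2 * Real.pi)) = h φ

end SineTransform

/-!
The link between the two observables is Weyl's character formula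
`χ_j (x h_φ x⁻¹) sin φ = sin ((2 j + 1) φ)`. Together with Weyl's integration formula it says that
the smeared particle observable `∫ h(φ) Δ(φ) ∏_e δ_{φ_e} dφ` is the continuous function `D` with
`D (x h_φ x⁻¹) Δ(φ) = h φ` (`isSmearedDelta_of_conjCartan`). For `h = ∏_e sin ((2 j_e + 1) φ_e)`
this is the product of the characters `χ_{j_e}`. So, up to exchanging the spins `0` and `j_e` on
`Γ`, the two sums over spins in the first formula have the same summands
(`expectationTerm_lengthObs_swapSpins`).

Weyl's integration formula for `SU(2)` (`SU2.map_conj_cartan`) is obtained without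
differential geometry. Averaging over conjugation reduces it to class functions, that is, to
functions of the trace, and Weierstrass approximation reduces these to powers of the trace. Their
integrals satisfy a two-step recursion, by left invariance under three one-parameter subgroups
(`SU2.integral_halfTrace_pow_recursion`), and so do the integrals of `sin² φ cos^n φ`.

A test function `h` has rapidly decaying sine coefficients `a_k` and is the sum of its sine series
(`IsSineTest.rapidDecay_sineCoeff`, `IsSineTest.sineSeries_sineCoeff`), and every rapidly decaying
family `a` comes from a test function (`isSineTest_sineSeries`). Since `|χ_k|` is bounded by the
dimension, `D = ∑_k a_k ∏_e χ_{k_e}` converges uniformly. This gives the existence of `D`, and it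
turns the expectation value for `h` into `∑_j ∑_k a_k t_{jk}`, where `t_{jk}` is the summand for
the test function `∏_e sin ((2 k_e + 1) φ_e)`. The second formula is the interchange
of these sums. The double series need not converge absolutely; the hypothesis is that the sum over
`j` converges for all rapidly decaying `a`, and the uniform boundedness principle
on `ℓ¹`, applied to the partial sums over `j`, provides the majorant that allows the interchange
(`RapidDecay.exists_bound_partial_sum`, `RapidDecay.hasSum_mul_tsum`).
-/

/-! ### The group `SU(2)` -/

namespace SU2

theorem adjugate_coe (g : SU2) : g.1.adjugate = star g.1 := by
  obtain ⟨h1, h2⟩ := Matrix.mem_specialUnitaryGroup_iff.1 g.2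
  have h3 : g.1 * g.1.adjugate = 1 := by rw [Matrix.mul_adjugate, h2, one_smul]
  exact (left_inv_eq_right_inv (Matrix.mem_unitaryGroup_iff'.1 h1) h3).symm

theorem apply_one_one (g : SU2) : g.1 1 1 = star (g.1 0 0) := by
  have := congrFun (congrFun (adjugate_coe g) 0) 0
  simpa [Matrix.adjugate_fin_two, Matrix.star_apply] using this

theorem apply_zero_one (g : SU2) : g.1 0 1 = -star (g.1 1 0) := by
  have := congrFun (congrFun (adjugate_coe g) 0) 1
  simp only [Matrix.adjugate_fin_two, Matrix.star_apply, Matrix.of_apply, Matrix.cons_val_zero,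
    Matrix.cons_val_one] at this
  rw [← this, neg_neg]

theorem normSq_add_normSq (g : SU2) :
    Complex.normSq (g.1 0 0) + Complex.normSq (g.1 1 0) = 1 := by
  have h2 := (Matrix.mem_specialUnitaryGroup_iff.1 g.2).2
  rw [Matrix.det_fin_two, apply_one_one, apply_zero_one] at h2
  have : ((Complex.normSq (g.1 0 0) + Complex.normSq (g.1 1 0) : ℝ) : ℂ) = 1 := by
    rw [← h2]
    push_cast
    rw [← Complex.mul_conj, ← Complex.mul_conj]
    simp
    ring
  exact_mod_cast this

/-- The element of `SU(2)` with first column `(a, b)`. -/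
def ofColumn (a b : ℂ) (h : Complex.normSq a + Complex.normSq b = 1) : SU2 :=
  ⟨!![a, -star b; b, star a], by
    have h' : a * star a + b * star b = 1 := by
      have : ((Complex.normSq a + Complex.normSq b : ℝ) : ℂ) = 1 := by rw [h]; simp
      rw [← this]
      push_cast
      rw [← Complex.mul_conj, ← Complex.mul_conj]
      simp
    rw [Matrix.mem_specialUnitaryGroup_iff, Matrix.mem_unitaryGroup_iff']
    constructor
    · ext i j
      fin_cases i <;> fin_cases j <;> simp [Matrix.mul_apply, Matrix.star_apply] at h' ⊢ <;>
        first | linear_combination h' | ring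
    · simp [Matrix.det_fin_two] at h' ⊢
      linear_combination h'⟩

theorem ext_column {g h : SU2} (h0 : g.1 0 0 = h.1 0 0) (h1 : g.1 1 0 = h.1 1 0) : g = h := by
  apply Subtype.ext
  ext i j
  fin_cases i <;> fin_cases j <;>
    simp [h0, h1, apply_one_one, apply_zero_one]

instance : ContinuousInv SU2 :=
  ⟨by
    refine Continuous.subtype_mk (f := fun g : SU2 => star g.1) ?_ _
    exact continuous_subtype_val.star⟩

instance : IsTopologicalGroup SU2 where

instance : CompactSpace SU2 := by
  let _ : NormedAddCommGroup (Matrix (Fin 2) (Fin 2) ℂ) := Matrix.normedAddCommGroup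
  let _ : NormedSpace ℂ (Matrix (Fin 2) (Fin 2) ℂ) := Matrix.normedSpace
  have : ProperSpace (Matrix (Fin 2) (Fin 2) ℂ) :=
    inferInstanceAs (ProperSpace (Fin 2 → Fin 2 → ℂ))
  apply isCompact_iff_compactSpace.1
  have hb : Bornology.IsBounded
      (Matrix.specialUnitaryGroup (Fin 2) ℂ : Set (Matrix (Fin 2) (Fin 2) ℂ)) := by
    refine (Metric.isBounded_closedBall (x := 0) (r := 1)).subset fun g hg => ?_
    rw [mem_closedBall_zero_iff]
    exact (Matrix.norm_le_iff zero_le_one).2 fun i j =>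
      entry_norm_bound_of_unitary (Matrix.specialUnitaryGroup_le_unitaryGroup hg) i j
  have hc : IsClosed (Matrix.specialUnitaryGroup (Fin 2) ℂ : Set (Matrix (Fin 2) (Fin 2) ℂ)) := by
    have : (Matrix.specialUnitaryGroup (Fin 2) ℂ : Set (Matrix (Fin 2) (Fin 2) ℂ)) =
        {A | A * star A = 1} ∩ {A | A.det = 1} := by
      ext A
      simp [Matrix.mem_specialUnitaryGroup_iff, Matrix.mem_unitaryGroup_iff]
    rw [this]
    refine IsClosed.inter (isClosed_eq ?_ continuous_const) (isClosed_eq ?_ continuous_const)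
    · exact continuous_id.mul continuous_id.star
    · exact continuous_id.matrix_det
  exact Metric.isCompact_of_isClosed_isBounded hc hb

instance : SecondCountableTopology SU2 :=
  have : SecondCountableTopology (Matrix (Fin 2) (Fin 2) ℂ) :=
    inferInstanceAs (SecondCountableTopology (Fin 2 → Fin 2 → ℂ))
  TopologicalSpace.Subtype.secondCountableTopology _

instance : TopologicalSpace.MetrizableSpace SU2 :=
  TopologicalSpace.metrizableSpace_of_t3_secondCountable _

theorem continuous_entry (i j : Fin 2) : Continuous fun g : SU2 => g.1 i j :=
  continuous_subtype_val.matrix_elem i j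

theorem continuous_cartan : Continuous cartan := by
  refine Continuous.subtype_mk (f := fun φ : ℝ =>
    (!![Complex.exp (φ * Complex.I), 0; 0, Complex.exp (-(φ * Complex.I))] :
      Matrix (Fin 2) (Fin 2) ℂ)) ?_ _
  refine continuous_matrix fun i j => ?_
  fin_cases i <;> fin_cases j <;> simp <;> fun_prop

/-- Half the trace of `g`, the cosine of its class angle. -/
def halfTrace (g : SU2) : ℝ := (g.1 0 0).re

theorem continuous_halfTrace : Continuous halfTrace :=
  Complex.continuous_re.comp (continuous_entry 0 0)

theorem abs_halfTrace_le (g : SU2) : |halfTrace g| ≤ 1 := by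
  have := normSq_add_normSq g
  rw [Complex.normSq_apply, Complex.normSq_apply] at this
  rw [abs_le_one_iff_mul_self_le_one, halfTrace]
  nlinarith [mul_self_nonneg (g.1 0 0).im, mul_self_nonneg (g.1 1 0).re,
    mul_self_nonneg (g.1 1 0).im]

/-- Every element of `SU(2)` is diagonalised by an element of `SU(2)`: if `v` is a unit
eigenvector for `e^{iφ}`, the element with first column `v` does it. -/
theorem exists_conj_cartan (g : SU2) :
    ∃ x : SU2, g = x * cartan (Real.arccos (halfTrace g)) * x⁻¹ := by
  set φ := Real.arccos (halfTrace g) with hφ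
  have hcos : Real.cos φ = halfTrace g :=
    Real.cos_arccos (abs_le.1 (abs_halfTrace_le g)).1 (abs_le.1 (abs_halfTrace_le g)).2
  set l := Complex.exp (φ * Complex.I) with hl
  have hll : l * star l = 1 := by
    rw [hl, Complex.star_def, ← Complex.exp_conj, ← Complex.exp_add]; simp
  have hsum : l + star l = g.1 0 0 + star (g.1 0 0) := by
    simp only [Complex.star_def]
    rw [Complex.add_conj, Complex.add_conj, hl, Complex.exp_ofReal_mul_I_re, hcos, halfTrace]
  have hn : g.1 0 0 * star (g.1 0 0) + g.1 1 0 * star (g.1 1 0) = 1 := by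
    have : ((Complex.normSq (g.1 0 0) + Complex.normSq (g.1 1 0) : ℝ) : ℂ) = 1 := by
      rw [normSq_add_normSq]; simp
    rw [← this]
    push_cast
    rw [← Complex.mul_conj, ← Complex.mul_conj]
    simp
  have hdet : (g.1 - l • (1 : Matrix (Fin 2) (Fin 2) ℂ)).det = 0 := by
    rw [Matrix.det_fin_two]
    simp only [Matrix.sub_apply, Matrix.smul_apply, apply_one_one, apply_zero_one]
    simp at hll hsum hn ⊢
    linear_combination l * hsum + hn - hll
  obtain ⟨v, hv0, hv⟩ := Matrix.exists_mulVec_eq_zero_iff.2 hdet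
  have e1 := congrFun hv 0
  have e2 := congrFun hv 1
  simp only [Matrix.mulVec, dotProduct, Fin.sum_univ_two, Matrix.sub_apply, Matrix.smul_apply,
    apply_one_one, apply_zero_one] at e1 e2
  simp at e1 e2
  set N : ℝ := Complex.normSq (v 0) + Complex.normSq (v 1) with hN
  have hNpos : 0 < N := by
    rcases lt_or_eq_of_le (add_nonneg (Complex.normSq_nonneg (v 0)) (Complex.normSq_nonneg (v 1)))
      with h | h
    · exact h
    · exfalso
      apply hv0
      have h0 := Complex.normSq_nonneg (v 0)
      have h1 := Complex.normSq_nonneg (v 1)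
      ext i
      fin_cases i
      · exact Complex.normSq_eq_zero.1 (show Complex.normSq (v 0) = 0 by linarith)
      · exact Complex.normSq_eq_zero.1 (show Complex.normSq (v 1) = 0 by linarith)
  set r : ℝ := (Real.sqrt N)⁻¹ with hr
  have hrr : r * r * N = 1 := by
    rw [hr, ← mul_inv, Real.mul_self_sqrt hNpos.le, inv_mul_cancel₀ hNpos.ne']
  have hcol : Complex.normSq (r * v 0) + Complex.normSq (r * v 1) = 1 := by
    rw [Complex.normSq_mul, Complex.normSq_mul, Complex.normSq_ofReal, ← mul_add]
    exact hrr
  refine ⟨ofColumn _ _ hcol, ?_⟩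
  rw [eq_mul_inv_iff_mul_eq]
  apply ext_column
  · change (g.1 * (ofColumn _ _ hcol).1 : Matrix _ _ ℂ) 0 0 =
      ((ofColumn _ _ hcol).1 * (cartan φ).1 : Matrix _ _ ℂ) 0 0
    simp only [Matrix.mul_apply, Fin.sum_univ_two, ofColumn, cartan, apply_zero_one]
    simp
    rw [← hl]
    linear_combination r * e1
  · change (g.1 * (ofColumn _ _ hcol).1 : Matrix _ _ ℂ) 1 0 =
      ((ofColumn _ _ hcol).1 * (cartan φ).1 : Matrix _ _ ℂ) 1 0
    simp only [Matrix.mul_apply, Fin.sum_univ_two, ofColumn, cartan, apply_one_one]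
    simp
    rw [← hl]
    linear_combination r * e2

end SU2

/-! ### Characters -/

/-- The exponents `(m, n - m)` of the monomials of degree `n` in two variables. -/
noncomputable def binaryExponent (n : ℕ) (m : Fin (n + 1)) : Fin 2 →₀ ℕ :=
  Finsupp.equivFunOnFinite.symm ![m, n - m]

theorem binaryExponent_degree (n : ℕ) (m : Fin (n + 1)) : (binaryExponent n m).degree = n := by
  rw [Finsupp.degree_eq_sum]
  simp [binaryExponent, Fin.sum_univ_two]
  omega

theorem binaryExponent_injective (n : ℕ) : Function.Injective (binaryExponent n) := by
  intro m m' h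
  have := DFunLike.congr_fun h 0
  simpa [binaryExponent, Fin.ext_iff] using this

theorem exists_binaryExponent_eq {n : ℕ} {d : Fin 2 →₀ ℕ} (hd : d.degree = n) :
    ∃ m, binaryExponent n m = d := by
  rw [Finsupp.degree_eq_sum, Fin.sum_univ_two] at hd
  refine ⟨⟨d 0, by omega⟩, ?_⟩
  ext i
  fin_cases i
  · simp [binaryExponent]
  · simp [binaryExponent]; omega

/-- The basis of monomials of the space of binary forms of degree `n`. -/
noncomputable def binaryFormBasis (n : ℕ) :
    Module.Basis (Fin (n + 1)) ℂ (MvPolynomial.homogeneousSubmodule (Fin 2) ℂ n) :=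
  Module.Basis.ofEquivFun
    { toFun := fun p m => p.1.coeff (binaryExponent n m)
      map_add' := fun p q => by ext; simp
      map_smul' := fun c p => by ext; simp
      invFun := fun c => ⟨∑ m, MvPolynomial.monomial (binaryExponent n m) (c m),
        Submodule.sum_mem _ fun m _ => (MvPolynomial.mem_homogeneousSubmodule n _).2
          (MvPolynomial.isHomogeneous_monomial _ (binaryExponent_degree n m))⟩
      left_inv := fun p => by
        apply Subtype.ext
        ext d
        simp only [MvPolynomial.coeff_sum, MvPolynomial.coeff_monomial]
        by_cases hd : d.degree = n
        · obtain ⟨m, rfl⟩ := exists_binaryExponent_eq hd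
          simp [(binaryExponent_injective n).eq_iff]
        · rw [((MvPolynomial.mem_homogeneousSubmodule n _).1 p.2).coeff_eq_zero hd]
          refine Finset.sum_eq_zero fun m _ => if_neg ?_
          rintro rfl
          exact hd (binaryExponent_degree n m)
      right_inv := fun c => by
        ext m
        simp [MvPolynomial.coeff_sum, MvPolynomial.coeff_monomial,
          (binaryExponent_injective n).eq_iff] }

theorem coe_binaryFormBasis (n : ℕ) (m : Fin (n + 1)) :
    (binaryFormBasis n m).1 = MvPolynomial.monomial (binaryExponent n m) 1 := by
  classical
  simp only [binaryFormBasis, Module.Basis.coe_ofEquivFun]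
  change ∑ m', MvPolynomial.monomial (binaryExponent n m') ((Pi.single m 1 : Fin (n + 1) → ℂ) m') = _
  rw [Finset.sum_eq_single m]
  · simp
  · intro b _ hb; simp [hb]
  · simp

theorem spinRep_cartan_basis (n : ℕ) (φ : ℝ) (m : Fin (n + 1)) :
    spinRep n (cartan φ) (binaryFormBasis n m) =
      (Complex.exp (φ * Complex.I) ^ (m : ℕ) * Complex.exp (-(φ * Complex.I)) ^ (n - m : ℕ)) •
        binaryFormBasis n m := by
  apply Subtype.ext
  change substHom (cartan φ).1 (binaryFormBasis n m).1 = _ • (binaryFormBasis n m).1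
  rw [coe_binaryFormBasis, MvPolynomial.monomial_eq]
  simp only [map_mul, map_pow, MvPolynomial.smul_eq_C_mul]
  simp [substHom, Finsupp.prod_fintype, binaryExponent, cartan, mul_pow, Fin.prod_univ_two]
  ring

/-- The weights of the spin `n / 2` representation. -/
theorem spinChar_cartan (n : ℕ) (φ : ℝ) :
    spinChar n (cartan φ) = ∑ m : Fin (n + 1),
      Complex.exp (φ * Complex.I) ^ (m : ℕ) * Complex.exp (-(φ * Complex.I)) ^ (n - m : ℕ) := by
  rw [spinChar, Representation.character,
    LinearMap.trace_eq_matrix_trace ℂ (binaryFormBasis n), Matrix.trace]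
  refine Finset.sum_congr rfl fun m _ => ?_
  rw [Matrix.diag_apply, LinearMap.toMatrix_apply, spinRep_cartan_basis]
  simp

theorem spinChar_conj (n : ℕ) (x g : SU2) : spinChar n (x * g * x⁻¹) = spinChar n g :=
  Representation.char_conj _ _ _

theorem spinChar_cartan_eq_eval (n : ℕ) (φ : ℝ) :
    spinChar n (cartan φ) = (Polynomial.Chebyshev.U ℂ n).eval (Real.cos φ : ℂ) := by
  rw [spinChar_cartan]
  set q := Complex.exp (φ * Complex.I) with hq
  set p := Complex.exp (-(φ * Complex.I)) with hp
  have hqp : q * p = 1 := by rw [hq, hp, ← Complex.exp_add]; simp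
  have hcos : 2 * Complex.cos φ = q + p := by
    rw [Complex.two_cos, hq, hp, neg_mul]
  have hS : ∀ n : ℕ, ∑ m : Fin (n + 1), q ^ (m : ℕ) * p ^ (n - m : ℕ) =
      ∑ m ∈ Finset.range (n + 1), q ^ m * p ^ (n - m) := fun n =>
    (Finset.sum_range (fun m => q ^ m * p ^ (n - m))).symm
  have hL : ∀ n : ℕ, ∑ m ∈ Finset.range (n + 2), q ^ m * p ^ (n + 1 - m) =
      q * (∑ m ∈ Finset.range (n + 1), q ^ m * p ^ (n - m)) + p ^ (n + 1) := fun n => by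
    rw [Finset.sum_range_succ', Finset.mul_sum]
    simp [pow_succ']
    refine Finset.sum_congr rfl fun m _ => by ring
  rw [hS]
  induction n using Nat.twoStepInduction with
  | zero => simp
  | one => simp [Finset.sum_range_succ, hcos, add_comm]
  | more n h1 h2 =>
    have h3 := Polynomial.Chebyshev.U_add_two ℂ n
    have h4 := hL n
    have h5 := hL (n + 1)
    push_cast at h1 h2 h3 ⊢
    rw [h3]
    simp only [Polynomial.eval_sub, Polynomial.eval_mul, Polynomial.eval_X, Polynomial.eval_ofNat]
    rw [← h1, ← h2, hcos]
    rw [show n + 2 + 1 = n + 1 + 2 from rfl, show n + 2 = n + 1 + 1 from rfl, h5, h4]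
    linear_combination (-(∑ m ∈ Finset.range (n + 1), q ^ m * p ^ (n - m))) * hqp

/-- The character as a polynomial in the trace. -/
theorem spinChar_eq_eval (n : ℕ) (g : SU2) :
    spinChar n g = (Polynomial.Chebyshev.U ℂ n).eval (SU2.halfTrace g : ℂ) := by
  obtain ⟨x, hx⟩ := SU2.exists_conj_cartan g
  have : spinChar n g = spinChar n (cartan (Real.arccos (SU2.halfTrace g))) := by
    conv_lhs => rw [hx]
    exact spinChar_conj _ _ _
  rw [this, spinChar_cartan_eq_eval, Real.cos_arccos (abs_le.1 (SU2.abs_halfTrace_le g)).1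
    (abs_le.1 (SU2.abs_halfTrace_le g)).2]

theorem continuous_spinChar (n : ℕ) : Continuous (spinChar n) := by
  simp only [funext (spinChar_eq_eval n)]
  exact (Polynomial.continuous _).comp (Complex.continuous_ofReal.comp SU2.continuous_halfTrace)

/-- Weyl's character formula for `SU(2)`. -/
theorem spinChar_conj_cartan_mul_sin (n : ℕ) (x : SU2) (φ : ℝ) :
    spinChar n (x * cartan φ * x⁻¹) * (Real.sin φ : ℂ) =
      (Real.sin ((spinDim n : ℝ) * φ) : ℂ) := by
  rw [spinChar_conj, spinChar_cartan_eq_eval]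
  have := Polynomial.Chebyshev.U_complex_cos φ n
  push_cast [spinDim] at this ⊢
  exact this

theorem norm_spinChar_le (n : ℕ) (g : SU2) : ‖spinChar n g‖ ≤ (spinDim n : ℝ) := by
  obtain ⟨x, hx⟩ := SU2.exists_conj_cartan g
  rw [hx, spinChar_conj, spinChar_cartan]
  refine (norm_sum_le _ _).trans ?_
  have h : ∀ φ : ℝ, ‖Complex.exp (-(φ * Complex.I))‖ = 1 := fun φ => by
    rw [show -((φ : ℂ) * Complex.I) = ((-φ : ℝ) : ℂ) * Complex.I by push_cast; ring]
    exact Complex.norm_exp_ofReal_mul_I _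
  simp [h, Complex.norm_exp_ofReal_mul_I, spinDim]

theorem spinChar_zero (g : SU2) : spinChar 0 g = 1 := by
  rw [spinChar_eq_eval]; simp

/-! ### Weyl's integration formula -/

namespace SU2

variable (μ : Measure SU2) [μ.IsHaarMeasure]

instance : μ.IsMulRightInvariant where
  map_mul_right_eq_self g := by
    have hfin : IsFiniteMeasure (μ.map (· * g)) := inferInstance
    have hleft : (μ.map (· * g)).IsMulLeftInvariant := inferInstance
    have h := Measure.isMulInvariant_eq_smul_of_compactSpace (μ.map (· * g)) μ
    set c := Measure.haarScalarFactor (μ.map (· * g)) μ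
    -- both measures have the same finite total mass, so the factor is one
    have huniv : (μ.map (· * g)) Set.univ = μ Set.univ := by
      rw [Measure.map_apply (measurable_mul_const g) MeasurableSet.univ, Set.preimage_univ]
    have h0 : μ Set.univ ≠ 0 := (isOpen_univ.measure_pos μ Set.univ_nonempty).ne'
    have hc : (c : ENNReal) = 1 := by
      rw [h, Measure.smul_apply, ENNReal.smul_def, smul_eq_mul] at huniv
      exact (ENNReal.mul_eq_right h0 (measure_ne_top _ _)).1 huniv
    rw [h, ENNReal.coe_eq_one.1 hc, one_smul]

omit [μ.IsHaarMeasure] in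
theorem integrable_of_continuous [IsFiniteMeasureOnCompacts μ] {V : Type*} [NormedAddCommGroup V]
    {f : SU2 → V} (hf : Continuous f) : Integrable f μ :=
  hf.integrable_of_hasCompactSupport (HasCompactSupport.of_compactSpace f)

/-- Left invariance along a one-parameter family that rotates the coordinates `halfTrace` and `y`
into each other, differentiated at the identity. -/
theorem integral_halfTrace_pow_succ_of_rotation (k : ℝ → SU2) (y : SU2 → ℝ) (hy : Continuous y)
    (hk : ∀ s g, halfTrace (k s * g) = Real.cos s * halfTrace g - Real.sin s * y g)
    (hky : ∀ s g, y (k s * g) = Real.sin s * halfTrace g + Real.cos s * y g) (n : ℕ) :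
    ∫ g, halfTrace g ^ (n + 1) ∂μ = n * ∫ g, halfTrace g ^ (n - 1) * y g ^ 2 ∂μ := by
  have hx := continuous_halfTrace
  have hderivx : ∀ (g : SU2) (s : ℝ), HasDerivAt (fun s => halfTrace (k s * g)) (-y (k s * g)) s := by
    intro g s
    simp only [hk, hky]
    exact (((Real.hasDerivAt_cos s).mul_const (halfTrace g)).fun_sub
      ((Real.hasDerivAt_sin s).mul_const (y g))).congr_deriv (by ring)
  have hderivy : ∀ (g : SU2) (s : ℝ), HasDerivAt (fun s => y (k s * g)) (halfTrace (k s * g)) s := by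
    intro g s
    simp only [hk, hky]
    exact (((Real.hasDerivAt_sin s).mul_const (halfTrace g)).fun_add
      ((Real.hasDerivAt_cos s).mul_const (y g))).congr_deriv (by ring)
  let D : SU2 → ℝ := fun g => n * halfTrace g ^ (n - 1) * (-y g) * y g + halfTrace g ^ n * halfTrace g
  have hDc : Continuous D := by fun_prop
  obtain ⟨C, hC⟩ : ∃ C, ∀ g, ‖D g‖ ≤ C := by
    obtain ⟨C, hC⟩ := isCompact_univ.exists_bound_of_continuousOn hDc.continuousOn
    exact ⟨C, fun g => hC g trivial⟩
  have hFc : Continuous fun g => halfTrace g ^ n * y g := by fun_prop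
  have key := (hasDerivAt_integral_of_dominated_loc_of_deriv_le (μ := μ) (x₀ := (0 : ℝ))
    (s := Set.univ) (F := fun s g => halfTrace (k s * g) ^ n * y (k s * g))
    (F' := fun s g => D (k s * g)) (bound := fun _ => C) Filter.univ_mem
    (Filter.Eventually.of_forall fun s =>
      (hFc.comp (continuous_const_mul (k s))).aestronglyMeasurable)
    (integrable_of_continuous μ (hFc.comp (continuous_const_mul (k 0))))
    ((hDc.comp (continuous_const_mul (k 0))).aestronglyMeasurable)
    (Filter.Eventually.of_forall fun g s _ => hC _) (integrable_const C)
    (Filter.Eventually.of_forall fun g s _ =>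
      ((hderivx g s).fun_pow n).fun_mul (hderivy g s))).2
  have hconst : (fun s : ℝ => ∫ g, halfTrace (k s * g) ^ n * y (k s * g) ∂μ) =
      fun _ => ∫ g, halfTrace g ^ n * y g ∂μ := by
    funext s
    exact integral_mul_left_eq_self (fun g => halfTrace g ^ n * y g) (k s)
  rw [hconst] at key
  have hzero := key.unique (hasDerivAt_const (0 : ℝ) _)
  rw [integral_mul_left_eq_self D (k 0)] at hzero
  have hsplit : D = fun g => halfTrace g ^ (n + 1) - n * (halfTrace g ^ (n - 1) * y g ^ 2) := by
    funext g; simp only [D]; ring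
  rw [hsplit, integral_sub (integrable_of_continuous μ (by fun_prop))
    (integrable_of_continuous μ (by fun_prop)), integral_const_mul] at hzero
  linarith

/-- The recursion for the moments of the half trace. -/
theorem integral_halfTrace_pow_recursion (n : ℕ) :
    (n + 3) * ∫ g, halfTrace g ^ (n + 1) ∂μ = n * ∫ g, halfTrace g ^ (n - 1) ∂μ := by
  have hx := continuous_halfTrace
  have hc1 : Continuous fun g : SU2 => (g.1 0 0).im := Complex.continuous_im.comp (continuous_entry 0 0)
  have hc2 : Continuous fun g : SU2 => (g.1 1 0).re := Complex.continuous_re.comp (continuous_entry 1 0)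
  have hc3 : Continuous fun g : SU2 => (g.1 1 0).im := Complex.continuous_im.comp (continuous_entry 1 0)
  have hmul : ∀ (h g : SU2) (i : Fin 2),
      (h * g).1 i 0 = h.1 i 0 * g.1 0 0 + h.1 i 1 * g.1 1 0 := fun h g i => by
    change (h.1 * g.1 : Matrix _ _ ℂ) i 0 = _
    rw [Matrix.mul_apply, Fin.sum_univ_two]
  have h1 := integral_halfTrace_pow_succ_of_rotation μ cartan (fun g => (g.1 0 0).im) hc1
    (fun s g => by
      simp [halfTrace, hmul, cartan, Complex.exp_ofReal_mul_I_re, Complex.exp_ofReal_mul_I_im])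
    (fun s g => by
      simp [halfTrace, hmul, cartan, Complex.exp_ofReal_mul_I_re, Complex.exp_ofReal_mul_I_im]
      ring) n
  have h2 := integral_halfTrace_pow_succ_of_rotation μ
    (fun s => ofColumn (Real.cos s) (Real.sin s) (by
      rw [Complex.normSq_ofReal, Complex.normSq_ofReal]; nlinarith [Real.sin_sq_add_cos_sq s]))
    (fun g => (g.1 1 0).re) hc2
    (fun s g => by
      simp only [halfTrace, hmul, ofColumn]
      simp [-Complex.ofReal_sin, -Complex.ofReal_cos]; ring)
    (fun s g => by
      simp only [halfTrace, hmul, ofColumn]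
      simp [-Complex.ofReal_sin, -Complex.ofReal_cos]) n
  have h3 := integral_halfTrace_pow_succ_of_rotation μ
    (fun s => ofColumn (Real.cos s) (Real.sin s * Complex.I) (by
      rw [Complex.normSq_mul, Complex.normSq_ofReal, Complex.normSq_ofReal, Complex.normSq_I]
      nlinarith [Real.sin_sq_add_cos_sq s]))
    (fun g => (g.1 1 0).im) hc3
    (fun s g => by
      simp only [halfTrace, hmul, ofColumn]
      simp [-Complex.ofReal_sin, -Complex.ofReal_cos]; ring)
    (fun s g => by
      simp only [halfTrace, hmul, ofColumn]
      simp [-Complex.ofReal_sin, -Complex.ofReal_cos]) n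
  have hi : ∀ {f : SU2 → ℝ}, Continuous f → Integrable f μ := fun hf => integrable_of_continuous μ hf
  have hsum : ∫ g, halfTrace g ^ (n - 1) * (g.1 0 0).im ^ 2 ∂μ +
      ∫ g, halfTrace g ^ (n - 1) * (g.1 1 0).re ^ 2 ∂μ +
      ∫ g, halfTrace g ^ (n - 1) * (g.1 1 0).im ^ 2 ∂μ =
      ∫ g, halfTrace g ^ (n - 1) ∂μ - ∫ g, halfTrace g ^ (n - 1) * halfTrace g ^ 2 ∂μ := by
    rw [← integral_add (hi (by fun_prop)) (hi (by fun_prop)),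
      ← integral_add (hi (by fun_prop)) (hi (by fun_prop)),
      ← integral_sub (hi (by fun_prop)) (hi (by fun_prop))]
    congr 1
    funext g
    have := normSq_add_normSq g
    rw [Complex.normSq_apply, Complex.normSq_apply] at this
    have hd : halfTrace g = (g.1 0 0).re := rfl
    rw [hd]
    linear_combination (g.1 0 0).re ^ (n - 1) * this
  have hpow : (n : ℝ) * ∫ g, halfTrace g ^ (n - 1) * halfTrace g ^ 2 ∂μ =
      n * ∫ g, halfTrace g ^ (n + 1) ∂μ := by
    rcases Nat.eq_zero_or_pos n with rfl | hn
    · simp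
    · congr 2
      funext g
      rw [← pow_add]
      congr 1
      omega
  linear_combination h1 + h2 + h3 + n * hsum - hpow

end SU2

/-- The density `(2/π) sin² φ` of the distribution of class angles. -/
noncomputable def weylDensity (φ : ℝ) : ℝ := 2 / Real.pi * Real.sin φ ^ 2

theorem weylDensity_nonneg (φ : ℝ) : 0 ≤ weylDensity φ := by
  unfold weylDensity
  have := Real.pi_pos
  positivity

theorem continuous_weylDensity : Continuous weylDensity := by
  unfold weylDensity; fun_prop

/-- The distribution of the class angle of a random element of `SU(2)`. -/
noncomputable def weylMeasure : Measure ℝ :=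
  (volume.restrict (Set.Icc 0 Real.pi)).withDensity fun φ => ENNReal.ofReal (weylDensity φ)

theorem integral_weylMeasure {V : Type*} [NormedAddCommGroup V] [NormedSpace ℝ V] (f : ℝ → V) :
    ∫ φ, f φ ∂weylMeasure = ∫ φ in Set.Icc 0 Real.pi, weylDensity φ • f φ := by
  rw [weylMeasure, integral_withDensity_eq_integral_toReal_smul
    (by have := continuous_weylDensity.measurable; fun_prop) (by simp)]
  simp [ENNReal.toReal_ofReal (weylDensity_nonneg _)]

instance : IsFiniteMeasure weylMeasure := by
  refine isFiniteMeasure_withDensity_ofReal ?_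
  exact (continuous_weylDensity.integrableOn_Icc).2

theorem integrable_weylMeasure_of_continuous {V : Type*} [NormedAddCommGroup V] {f : ℝ → V}
    (hf : Continuous f) : Integrable f weylMeasure := by
  obtain ⟨C, hC⟩ := (isCompact_Icc (a := (0 : ℝ)) (b := Real.pi)).exists_bound_of_continuousOn
    hf.continuousOn
  refine Integrable.of_bound hf.aestronglyMeasurable C ?_
  refine (withDensity_absolutelyContinuous _ _).ae_le ?_
  exact (ae_restrict_iff' measurableSet_Icc).2 (Filter.Eventually.of_forall hC)

/-- The moments of `cos φ` under the Weyl measure satisfy the recursion of the moments of the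
half trace; this is `(sin³ φ cos^n φ)' = 3 sin² φ cos^{n+1} φ - n sin⁴ φ cos^{n-1} φ`. -/
theorem integral_cos_pow_recursion (n : ℕ) :
    (n + 3) * ∫ φ, Real.cos φ ^ (n + 1) ∂weylMeasure =
      n * ∫ φ, Real.cos φ ^ (n - 1) ∂weylMeasure := by
  have hd : ∀ φ ∈ Set.uIcc 0 Real.pi, HasDerivAt
      (fun φ => Real.sin φ ^ 3 * Real.cos φ ^ n)
      ((n + 3) * (Real.sin φ ^ 2 * Real.cos φ ^ (n + 1)) -
        n * (Real.sin φ ^ 2 * Real.cos φ ^ (n - 1))) φ := fun φ _ => by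
    refine (((Real.hasDerivAt_sin φ).fun_pow 3).fun_mul
      ((Real.hasDerivAt_cos φ).fun_pow n)).congr_deriv ?_
    have h1 : (n : ℝ) * Real.cos φ ^ (n - 1) * Real.cos φ ^ 2 = n * Real.cos φ ^ (n + 1) := by
      rcases Nat.eq_zero_or_pos n with rfl | hn
      · simp
      · rw [mul_assoc, ← pow_add]
        congr 2
        omega
    have h2 : Real.sin φ ^ 4 = Real.sin φ ^ 2 * (1 - Real.cos φ ^ 2) := by
      rw [Real.cos_sq']; ring
    push_cast
    linear_combination (-(n : ℝ) * Real.cos φ ^ (n - 1)) * h2 + Real.sin φ ^ 2 * h1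
  have hint : ∀ m : ℕ, IntervalIntegrable (fun φ => Real.sin φ ^ 2 * Real.cos φ ^ m) volume 0 Real.pi :=
    fun m => Continuous.intervalIntegrable (by fun_prop) _ _
  have h := intervalIntegral.integral_eq_sub_of_hasDerivAt hd
    (((hint _).const_mul _).sub ((hint _).const_mul _))
  rw [intervalIntegral.integral_sub ((hint _).const_mul _) ((hint _).const_mul _),
    intervalIntegral.integral_const_mul, intervalIntegral.integral_const_mul] at h
  have hm : ∀ m : ℕ, ∫ φ, Real.cos φ ^ m ∂weylMeasure =
      2 / Real.pi * ∫ φ in (0 : ℝ)..Real.pi, Real.sin φ ^ 2 * Real.cos φ ^ m := fun m => by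
    rw [integral_weylMeasure, intervalIntegral.integral_of_le Real.pi_pos.le,
      integral_Icc_eq_integral_Ioc, ← integral_const_mul]
    simp [weylDensity, mul_assoc]
  rw [hm, hm]
  simp at h
  linear_combination 2 / Real.pi * h

theorem integral_one_weylMeasure : ∫ _, (1 : ℝ) ∂weylMeasure = 1 := by
  rw [integral_weylMeasure, integral_Icc_eq_integral_Ioc,
    ← intervalIntegral.integral_of_le Real.pi_pos.le]
  simp only [weylDensity, smul_eq_mul, mul_one]
  rw [intervalIntegral.integral_const_mul, integral_sin_sq]
  have := Real.pi_pos.ne'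
  simp [this]

namespace SU2

variable (μ : Measure SU2) [μ.IsHaarMeasure]

theorem integral_halfTrace_pow (n : ℕ) :
    ∫ g, halfTrace g ^ n ∂μ = μ.real Set.univ * ∫ φ, Real.cos φ ^ n ∂weylMeasure := by
  induction n using Nat.twoStepInduction with
  | zero => simp [-integral_const, integral_one_weylMeasure]; simp
  | one =>
    have h1 := integral_halfTrace_pow_recursion μ 0
    have h2 := integral_cos_pow_recursion 0
    simp at h1 h2
    simp [h1, h2]
  | more n h1 _ =>
    have h2 := integral_halfTrace_pow_recursion μ (n + 1)
    have h3 := integral_cos_pow_recursion (n + 1)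
    rw [Nat.add_sub_cancel] at h2 h3
    have : ((n + 1 : ℕ) : ℝ) + 3 ≠ 0 := by positivity
    apply mul_left_cancel₀ this
    rw [h2, h1]
    linear_combination (-μ.real Set.univ) * h3

theorem integral_polynomial_halfTrace (p : Polynomial ℝ) :
    ∫ g, p.eval (halfTrace g) ∂μ = μ.real Set.univ * ∫ φ, p.eval (Real.cos φ) ∂weylMeasure := by
  have hx := continuous_halfTrace
  simp only [Polynomial.eval_eq_sum_range]
  rw [integral_finsetSum _ fun i _ => integrable_of_continuous μ (by fun_prop),
    integral_finsetSum _ fun i _ => integrable_weylMeasure_of_continuous (by fun_prop),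
    Finset.mul_sum]
  refine Finset.sum_congr rfl fun i _ => ?_
  rw [integral_const_mul, integral_const_mul, integral_halfTrace_pow]
  ring

/-- Weyl's integration formula for class functions, from that for polynomials in the trace by
Weierstrass approximation. -/
theorem integral_comp_halfTrace {f : ℝ → ℝ} (hf : Continuous f) :
    ∫ g, f (halfTrace g) ∂μ = μ.real Set.univ * ∫ φ, f (Real.cos φ) ∂weylMeasure := by
  have hx := continuous_halfTrace
  set V := μ.real Set.univ with hV
  have hV0 : 0 ≤ V := measureReal_nonneg
  have hw : weylMeasure.real Set.univ = 1 := by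
    have := integral_one_weylMeasure
    simpa using this
  refine eq_of_forall_dist_le fun ε hε => ?_
  rw [Real.dist_eq]
  obtain ⟨p, hp⟩ := exists_polynomial_near_of_continuousOn (-1) 1 f hf.continuousOn
    (ε / (2 * V + 1)) (by positivity)
  have h1 : ‖∫ g, (p.eval (halfTrace g) - f (halfTrace g)) ∂μ‖ ≤ ε / (2 * V + 1) * V :=
    norm_integral_le_of_norm_le_const (Filter.Eventually.of_forall fun g =>
      (hp _ (abs_le.1 (abs_halfTrace_le g))).le)
  have h2 : ‖∫ φ, (p.eval (Real.cos φ) - f (Real.cos φ)) ∂weylMeasure‖ ≤ ε / (2 * V + 1) * 1 := by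
    have h := norm_integral_le_of_norm_le_const (μ := weylMeasure) (C := ε / (2 * V + 1))
      (f := fun φ => p.eval (Real.cos φ) - f (Real.cos φ))
      (Filter.Eventually.of_forall fun φ =>
        (hp _ ⟨Real.neg_one_le_cos φ, Real.cos_le_one φ⟩).le)
    rwa [hw] at h
  rw [integral_sub (integrable_of_continuous μ (by fun_prop))
    (integrable_of_continuous μ (by fun_prop)), integral_polynomial_halfTrace, Real.norm_eq_abs] at h1
  rw [integral_sub (integrable_weylMeasure_of_continuous (by fun_prop))
    (integrable_weylMeasure_of_continuous (by fun_prop)), Real.norm_eq_abs] at h2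
  have h3 : ε / (2 * V + 1) * (2 * V) ≤ ε := by
    rw [div_mul_eq_mul_div, div_le_iff₀ (by positivity)]
    nlinarith
  have h4 := mul_le_mul_of_nonneg_left h2 hV0
  rw [← abs_of_nonneg hV0, ← abs_mul, abs_of_nonneg hV0] at h4
  rw [← hV] at h1
  rw [abs_le] at *
  constructor <;> nlinarith

/-- Weyl's integration formula: conjugating `cartan φ` by a random `x`, with `φ` distributed
according to `weylMeasure`, gives Haar measure. -/
theorem map_conj_cartan :
    (μ.prod weylMeasure).map (fun p : SU2 × ℝ => p.1 * cartan p.2 * p.1⁻¹) = μ := by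
  have hcart := continuous_cartan
  have hx := continuous_halfTrace
  have hc : Continuous fun p : SU2 × ℝ => p.1 * cartan p.2 * p.1⁻¹ := by fun_prop
  refine ext_of_forall_integral_eq_of_IsFiniteMeasure fun F => ?_
  have hF := F.continuous
  rw [integral_map hc.aemeasurable hF.aestronglyMeasurable]
  have hint : Integrable (fun p : SU2 × ℝ => F (p.1 * cartan p.2 * p.1⁻¹)) (μ.prod weylMeasure) :=
    Integrable.of_bound (hF.comp hc).aestronglyMeasurable ‖F‖
      (Filter.Eventually.of_forall fun p => F.norm_coe_le_norm _)
  rw [integral_prod_symm _ hint]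
  -- the average of `F` over a conjugacy class, as a function of the half trace
  set f : ℝ → ℝ := fun t => ∫ x, F (x * cartan (Real.arccos t) * x⁻¹) ∂μ with hf
  have hfc : Continuous f := by
    have := continuous_parametric_integral_of_continuous (μ := μ)
      (f := fun (t : ℝ) (x : SU2) => F (x * cartan (Real.arccos t) * x⁻¹))
      (by
        have := Real.continuous_arccos
        unfold Function.uncurry
        fun_prop) isCompact_univ
    simpa using this
  have hV : μ.real Set.univ ≠ 0 := by
    rw [measureReal_def, ENNReal.toReal_ne_zero]
    exact ⟨(isOpen_univ.measure_pos μ Set.univ_nonempty).ne', measure_ne_top _ _⟩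
  have hleft : ∫ φ, ∫ x, F (x * cartan φ * x⁻¹) ∂μ ∂weylMeasure =
      ∫ φ, f (Real.cos φ) ∂weylMeasure := by
    rw [integral_weylMeasure, integral_weylMeasure]
    refine setIntegral_congr_fun measurableSet_Icc fun φ hφ => ?_
    simp only [hf, Real.arccos_cos hφ.1 hφ.2]
  have hclass : ∀ g, f (halfTrace g) = ∫ x, F (x * g * x⁻¹) ∂μ := fun g => by
    obtain ⟨y, hy⟩ := exists_conj_cartan g
    calc f (halfTrace g) = ∫ x, F (x * y * cartan (Real.arccos (halfTrace g)) * (x * y)⁻¹) ∂μ :=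
          (integral_mul_right_eq_self
            (fun x => F (x * cartan (Real.arccos (halfTrace g)) * x⁻¹)) y).symm
      _ = ∫ x, F (x * g * x⁻¹) ∂μ := by
          congr 1
          funext x
          conv_rhs => rw [hy]
          congr 1
          group
  have hswap : ∫ g, f (halfTrace g) ∂μ = μ.real Set.univ * ∫ g, F g ∂μ := by
    simp only [hclass]
    rw [integral_integral_swap]
    · have : ∀ x : SU2, ∫ g, F (x * g * x⁻¹) ∂μ = ∫ g, F g ∂μ := fun x => by
        rw [integral_mul_left_eq_self (fun g => F (g * x⁻¹)) x,
          integral_mul_right_eq_self (fun g => F g) x⁻¹]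
      simp [this]
    · exact Integrable.of_bound (Continuous.aestronglyMeasurable
        (by unfold Function.uncurry; fun_prop)) ‖F‖
        (Filter.Eventually.of_forall fun p => F.norm_coe_le_norm _)
  rw [hleft]
  apply mul_left_cancel₀ hV
  rw [← integral_comp_halfTrace μ hfc, hswap]

end SU2

section ProductWeyl

variable {ι : Type*} [Fintype ι]

theorem MeasureTheory.Measure.pi_const_smul {X : ι → Type*} [∀ i, MeasurableSpace (X i)] (c : ENNReal)
    (hc : c ≠ ⊤) (μ : ∀ i, Measure (X i)) [∀ i, SigmaFinite (μ i)] :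
    Measure.pi (fun i => c • μ i) = c ^ Fintype.card ι • Measure.pi μ := by
  lift c to NNReal using hc
  have : ∀ i, SigmaFinite ((c : ENNReal) • μ i) := fun i =>
    inferInstanceAs (SigmaFinite (c • μ i))
  refine Measure.pi_eq (μ := fun i => (c : ENNReal) • μ i)
    (μ' := (c : ENNReal) ^ Fintype.card ι • Measure.pi μ)
    (fun s hs => ?_)
  simp [Measure.pi_pi, Finset.prod_mul_distrib]

theorem pi_weylMeasure :
    Measure.pi (fun _ : ι => weylMeasure) =
      (volume.restrict (Set.univ.pi fun _ : ι => Set.Icc 0 Real.pi)).withDensity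
        fun φ => ENNReal.ofReal (∏ e, weylDensity (φ e)) := by
  refine Measure.pi_eq fun s hs => ?_
  have hw := continuous_weylDensity
  have hms : MeasurableSet (Set.univ.pi s) := MeasurableSet.univ_pi hs
  have hi : ∀ e, Integrable weylDensity
      ((volume.restrict (Set.Icc 0 Real.pi)).restrict (s e)) := fun e => by
    have h : Integrable weylDensity (volume.restrict (Set.Icc 0 Real.pi)) := hw.integrableOn_Icc
    exact h.mono_measure Measure.restrict_le_self
  rw [withDensity_apply _ hms, volume_pi, Measure.restrict_pi_pi, Measure.restrict_pi_pi,
    ← ofReal_integral_eq_lintegral_ofReal, integral_fintype_prod_eq_prod,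
    ENNReal.ofReal_prod_of_nonneg fun e _ => integral_nonneg weylDensity_nonneg]
  · refine Finset.prod_congr rfl fun e _ => ?_
    rw [weylMeasure, withDensity_apply _ (hs e), ← ofReal_integral_eq_lintegral_ofReal (hi e)
      (Filter.Eventually.of_forall weylDensity_nonneg)]
  · exact Integrable.fintype_prod hi
  · exact Filter.Eventually.of_forall fun φ => Finset.prod_nonneg fun e _ => weylDensity_nonneg _

theorem prod_weylDensity (φ : ι → ℝ) :
    ((∏ e, weylDensity (φ e) : ℝ) : ℂ) =
      (2 / Real.pi : ℂ) ^ Fintype.card ι * (weylDelta φ * weylDelta φ) := by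
  rw [weylDelta, ← Finset.prod_mul_distrib, ← Finset.card_univ, ← Finset.prod_const,
    ← Finset.prod_mul_distrib, Complex.ofReal_prod]
  refine Finset.prod_congr rfl fun e _ => ?_
  rw [weylDensity]
  push_cast
  ring

/-- Componentwise conjugation of the Cartan elements `cartan (φ e)` by `x e`. -/
noncomputable def conjCartan (x : ι → SU2) (φ : ι → ℝ) : ι → SU2 :=
  fun e => x e * cartan (φ e) * (x e)⁻¹

omit [Fintype ι] in
theorem continuous_conjCartan : Continuous fun p : (ι → SU2) × (ι → ℝ) => conjCartan p.1 p.2 := by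
  have := SU2.continuous_cartan
  unfold conjCartan
  fun_prop

variable (μ : Measure SU2) [μ.IsHaarMeasure]

theorem measurePreserving_conjCartan :
    MeasurePreserving (fun p : (ι → SU2) × (ι → ℝ) => conjCartan p.1 p.2)
      ((Measure.pi fun _ => μ).prod (Measure.pi fun _ => weylMeasure)) (Measure.pi fun _ => μ) := by
  have hcart := SU2.continuous_cartan
  have h1 : MeasurePreserving (fun p : SU2 × ℝ => p.1 * cartan p.2 * p.1⁻¹)
      (μ.prod weylMeasure) μ :=
    ⟨(by fun_prop : Continuous fun p : SU2 × ℝ => p.1 * cartan p.2 * p.1⁻¹).measurable,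
      SU2.map_conj_cartan μ⟩
  have h2 := measurePreserving_pi (fun _ : ι => μ.prod weylMeasure) (fun _ => μ) fun _ => h1
  have h3 := (measurePreserving_arrowProdEquivProdArrow SU2 ℝ ι (fun _ => μ)
    (fun _ => weylMeasure)).symm
  have h4 := h2.comp h3
  have h5 : (fun p : (ι → SU2) × (ι → ℝ) => conjCartan p.1 p.2) =
      (fun (a : ι → SU2 × ℝ) e => (a e).1 * cartan (a e).2 * (a e).1⁻¹) ∘
        (MeasurableEquiv.arrowProdEquivProdArrow SU2 ℝ ι).symm := rfl
  rw [h5]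
  exact h4

theorem pi_conjDelta (φ : ι → ℝ) :
    Measure.pi (fun e : ι => conjDelta μ (φ e)) =
      ENNReal.ofReal (2 / Real.pi) ^ Fintype.card ι •
        (Measure.pi fun _ : ι => μ).map fun x => conjCartan x φ := by
  have hm : ∀ e, Measurable fun x : SU2 => x * cartan (φ e) * x⁻¹ := fun e =>
    (by fun_prop : Continuous fun x : SU2 => x * cartan (φ e) * x⁻¹).measurable
  have h1 := Measure.pi_map_pi (μ := fun _ : ι => μ)
    (f := fun e (x : SU2) => x * cartan (φ e) * x⁻¹) fun e => (hm e).aemeasurable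
  have h2 := Measure.pi_const_smul (ENNReal.ofReal (2 / Real.pi)) ENNReal.ofReal_ne_top
      fun e => μ.map fun x : SU2 => x * cartan (φ e) * x⁻¹
  rw [← h1] at h2
  exact h2

theorem integral_pi_conjDelta (φ : ι → ℝ) (ψ : C(ι → SU2, ℂ)) :
    ∫ G, ψ G ∂(Measure.pi fun e : ι => conjDelta μ (φ e)) =
      (2 / Real.pi : ℂ) ^ Fintype.card ι * ∫ x, ψ (conjCartan x φ) ∂(Measure.pi fun _ => μ) := by
  have hc : Continuous fun x : ι → SU2 => conjCartan x φ :=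
    by unfold conjCartan; fun_prop
  have hreal : (ENNReal.ofReal (2 / Real.pi) ^ Fintype.card ι).toReal =
      (2 / Real.pi) ^ Fintype.card ι := by
    rw [ENNReal.toReal_pow, ENNReal.toReal_ofReal (by have := Real.pi_pos; positivity)]
  rw [pi_conjDelta, integral_smul_measure,
    integral_map hc.aemeasurable ψ.continuous.aestronglyMeasurable, hreal, Complex.real_smul]
  push_cast
  rfl

theorem integrable_pi_of_continuous {V : Type*} [NormedAddCommGroup V]
    {f : (ι → SU2) → V} (hf : Continuous f) :
    Integrable f (Measure.pi fun _ : ι => μ) :=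
  hf.integrable_of_hasCompactSupport (HasCompactSupport.of_compactSpace f)

/-- Weyl's integration formula on `G^ι`: a continuous function `D` with boundary value
`D (x h_φ x⁻¹) Δ(φ) = h φ` is the density of `∫ h(φ) Δ(φ) ⨂ δ_{φ_e} dφ`. -/
theorem isSmearedDelta_of_conjCartan {h : (ι → ℝ) → ℂ} {D : (ι → SU2) → ℂ} (hD : Continuous D)
    (hh : ∀ φ ∈ Set.univ.pi (fun _ : ι => Set.Icc 0 Real.pi), ∀ x,
      D (conjCartan x φ) * weylDelta φ = h φ) :
    IsSmearedDelta μ (fun φ => h φ * weylDelta φ) D := by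
  refine ⟨hD, fun ψ => ?_⟩
  have hmp := measurePreserving_conjCartan (ι := ι) μ
  have hcont : Continuous fun G => D G * ψ G := hD.mul ψ.continuous
  obtain ⟨C, hC⟩ := isCompact_univ.exists_bound_of_continuousOn hcont.continuousOn
  have hint : Integrable (fun p : (ι → SU2) × (ι → ℝ) =>
      D (conjCartan p.1 p.2) * ψ (conjCartan p.1 p.2))
      ((Measure.pi fun _ => μ).prod (Measure.pi fun _ => weylMeasure)) :=
    Integrable.of_bound (hcont.comp continuous_conjCartan).aestronglyMeasurable C
      (Filter.Eventually.of_forall fun p => hC _ trivial)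
  rw [← hmp.map_eq, integral_map hmp.measurable.aemeasurable hcont.aestronglyMeasurable,
    integral_prod_symm _ hint, pi_weylMeasure,
    integral_withDensity_eq_integral_toReal_smul ?_ (by simp)]
  · refine setIntegral_congr_fun (MeasurableSet.univ_pi fun _ => measurableSet_Icc) fun φ hφ => ?_
    simp only
    rw [integral_pi_conjDelta, ENNReal.toReal_ofReal
      (Finset.prod_nonneg fun e _ => weylDensity_nonneg _), Complex.real_smul, prod_weylDensity,
      ← integral_const_mul, ← integral_const_mul, ← integral_const_mul]
    congr 1
    funext x
    rw [← hh φ hφ x]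
    ring
  · have := continuous_weylDensity
    exact (ENNReal.continuous_ofReal.comp (by fun_prop :
      Continuous fun φ : ι → ℝ => ∏ e, weylDensity (φ e))).measurable

theorem IsSmearedDelta.unique {f : (ι → ℝ) → ℂ} {D D' : (ι → SU2) → ℂ}
    (hD : IsSmearedDelta μ f D) (hD' : IsSmearedDelta μ f D') : D = D' := by
  have hc : Continuous fun G => D G - D' G := hD.1.sub hD'.1
  let ψ : C(ι → SU2, ℂ) := ⟨fun G => star (D G - D' G), hc.star⟩
  have h1 : Integrable (fun G => D G * ψ G) (Measure.pi fun _ : ι => μ) :=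
    integrable_pi_of_continuous μ (hD.1.mul ψ.continuous)
  have h1' : Integrable (fun G => D' G * ψ G) (Measure.pi fun _ : ι => μ) :=
    integrable_pi_of_continuous μ (hD'.1.mul ψ.continuous)
  have h2 : ∫ G, Complex.normSq (D G - D' G) ∂(Measure.pi fun _ : ι => μ) = 0 := by
    have h3 : ∀ G, D G * ψ G - D' G * ψ G = ((Complex.normSq (D G - D' G) : ℝ) : ℂ) := fun G => by
      rw [← sub_mul]
      exact Complex.mul_conj _
    have h4 := integral_sub h1 h1'
    rw [hD.2 ψ, hD'.2 ψ, sub_self] at h4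
    simp only [h3] at h4
    rw [← Complex.ofReal_eq_zero, ← h4]
    exact (integral_ofReal (𝕜 := ℂ)).symm
  have hc2 : Continuous fun G => Complex.normSq (D G - D' G) := Complex.continuous_normSq.comp hc
  rw [integral_eq_zero_iff_of_nonneg (fun G => Complex.normSq_nonneg _)
    (integrable_pi_of_continuous μ hc2)] at h2
  have h5 := (Continuous.ae_eq_iff_eq (Measure.pi fun _ : ι => μ) hc2
    (continuous_const (y := (0 : ℝ)))).1 h2
  funext G
  exact sub_eq_zero.1 (Complex.normSq_eq_zero.1 (congrFun h5 G))

theorem IsSmearedDelta.smearedDelta_eq {f : (ι → ℝ) → ℂ} {D : (ι → SU2) → ℂ}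
    (hD : IsSmearedDelta μ f D) : smearedDelta μ f = D := by
  have hex : ∃ D, IsSmearedDelta μ f D := ⟨D, hD⟩
  rw [smearedDelta, dif_pos hex]
  exact IsSmearedDelta.unique μ hex.choose_spec hD

end ProductWeyl

/-! ### Rapidly decaying sine coefficients -/

section SineSeries

variable {ι : Type*} [Fintype ι]

/-- The product of the dimensions `d_{k_e}`. -/
def spinWeight (k : ι → TwiceSpin) : ℝ := ∏ e, (spinDim (k e) : ℝ)

theorem one_le_spinDim (n : TwiceSpin) : (1 : ℝ) ≤ spinDim n := by
  simp [spinDim]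

theorem one_le_spinWeight (k : ι → TwiceSpin) : 1 ≤ spinWeight k :=
  Finset.one_le_prod fun _ _ => one_le_spinDim _

theorem spinWeight_pos (k : ι → TwiceSpin) : 0 < spinWeight k :=
  zero_lt_one.trans_le (one_le_spinWeight k)

theorem summable_inv_spinDim_sq : Summable fun n : ℕ => ((spinDim n : ℝ) ^ 2)⁻¹ := by
  have h := (summable_nat_add_iff (f := fun n : ℕ => ((n : ℝ) ^ 2)⁻¹) 1).2
    (Real.summable_nat_pow_inv.2 one_lt_two)
  exact h

theorem inv_spinWeight_sq (k : ι → TwiceSpin) :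
    (spinWeight k ^ 2)⁻¹ = ∏ e, ((spinDim (k e) : ℝ) ^ 2)⁻¹ := by
  rw [spinWeight, ← Finset.prod_pow, Finset.prod_inv_distrib]

theorem summable_inv_spinWeight_sq : Summable fun k : ι → TwiceSpin => (spinWeight k ^ 2)⁻¹ := by
  classical
  refine summable_of_sum_le (c := ∏ _e : ι, ∑' n : ℕ, ((spinDim n : ℝ) ^ 2)⁻¹)
    (fun k => inv_nonneg.2 (pow_nonneg (spinWeight_pos k).le 2)) fun u => ?_
  have hnn : ∀ n : TwiceSpin, 0 ≤ ((spinDim n : ℝ) ^ 2)⁻¹ := fun n =>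
    inv_nonneg.2 (pow_nonneg (zero_le_one.trans (one_le_spinDim n)) 2)
  simp only [inv_spinWeight_sq]
  have h1 : ∑ k ∈ u, ∏ e, ((spinDim (k e) : ℝ) ^ 2)⁻¹ ≤
      ∑ k ∈ Fintype.piFinset fun e => u.image fun k => k e, ∏ e, ((spinDim (k e) : ℝ) ^ 2)⁻¹ :=
    Finset.sum_le_sum_of_subset_of_nonneg
      (fun k hk => Fintype.mem_piFinset.2 fun e => Finset.mem_image_of_mem _ hk)
      fun _ _ _ => Finset.prod_nonneg fun _ _ => hnn _
  refine h1.trans ?_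
  rw [← Finset.prod_univ_sum (fun e => u.image fun k => k e)
    fun (_ : ι) (n : ℕ) => ((spinDim n : ℝ) ^ 2)⁻¹]
  exact Finset.prod_le_prod (fun _ _ => Finset.sum_nonneg fun _ _ => hnn _)
    fun e _ => summable_inv_spinDim_sq.sum_le_tsum _ fun _ _ => hnn _

/-- Coefficients that decay faster than every power of the dimensions. -/
def RapidDecay (a : (ι → TwiceSpin) → ℂ) : Prop :=
  ∀ N : ℕ, ∃ C : ℝ, ∀ k, ‖a k‖ * spinWeight k ^ N ≤ C

theorem RapidDecay.summable {a : (ι → TwiceSpin) → ℂ} (ha : RapidDecay a) (N : ℕ) :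
    Summable fun k => ‖a k‖ * spinWeight k ^ N := by
  obtain ⟨C, hC⟩ := ha (N + 2)
  refine Summable.of_nonneg_of_le (fun k => ?_) (fun k => ?_) (summable_inv_spinWeight_sq.mul_left C)
  · have := spinWeight_pos k
    positivity
  · have h0 := spinWeight_pos k
    rw [← div_eq_mul_inv, le_div_iff₀ (by positivity), mul_assoc, ← pow_add]
    exact hC k

theorem RapidDecay.summable_norm {a : (ι → TwiceSpin) → ℂ} (ha : RapidDecay a) :
    Summable fun k => ‖a k‖ := by
  simpa using ha.summable 0

theorem norm_sineKernel_le (k : ι → TwiceSpin) (φ : ι → ℝ) : ‖sineKernel k φ‖ ≤ 1 := by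
  rw [sineKernel, norm_prod]
  refine Finset.prod_le_one (fun _ _ => norm_nonneg _) fun e _ => ?_
  rw [Complex.norm_real]
  exact Real.abs_sin_le_one _

theorem continuous_sineKernel (k : ι → TwiceSpin) : Continuous (sineKernel k) := by
  unfold sineKernel; fun_prop

/-- The sine series with coefficients `a`. -/
noncomputable def sineSeries (a : (ι → TwiceSpin) → ℂ) (φ : ι → ℝ) : ℂ :=
  ∑' k, a k * sineKernel k φ

theorem contDiff_sineFactor (n : TwiceSpin) (e : ι) :
    ContDiff ℝ ∞ fun φ : ι → ℝ => (Real.sin ((spinDim n : ℝ) * φ e) : ℂ) := by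
  have h : ContDiff ℝ ∞ fun φ : ι → ℝ => Real.sin ((spinDim n : ℝ) * φ e) := by fun_prop
  exact Complex.ofRealCLM.contDiff.comp h

theorem norm_iteratedFDeriv_sineFactor_le (n : TwiceSpin) (e : ι) (m : ℕ) (φ : ι → ℝ) :
    ‖iteratedFDeriv ℝ m (fun φ : ι → ℝ => (Real.sin ((spinDim n : ℝ) * φ e) : ℂ)) φ‖ ≤
      (spinDim n : ℝ) ^ m := by
  let l : (ι → ℝ) →L[ℝ] ℝ := (spinDim n : ℝ) • ContinuousLinearMap.proj e
  have hl : ‖l‖ ≤ spinDim n := by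
    refine ContinuousLinearMap.opNorm_le_bound _ (by positivity) fun φ => ?_
    simp only [l, smul_apply, ContinuousLinearMap.proj_apply, norm_smul]
    rw [Real.norm_of_nonneg (by positivity)]
    exact mul_le_mul_of_nonneg_left (norm_le_pi_norm φ e) (by positivity)
  have h1 : (fun φ : ι → ℝ => (Real.sin ((spinDim n : ℝ) * φ e) : ℂ)) =
      Complex.ofRealLI ∘ (Real.sin ∘ l) := by
    funext φ
    simp [l]
  have hs : ContDiff ℝ ∞ Real.sin := Real.contDiff_sin
  rw [h1, LinearIsometry.norm_iteratedFDeriv_comp_left Complex.ofRealLI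
    ((hs.comp l.contDiff).contDiffAt) (i := m) (by exact_mod_cast le_top),
    l.iteratedFDeriv_comp_right hs φ (i := m) (by exact_mod_cast le_top)]
  refine (ContinuousMultilinearMap.norm_compContinuousLinearMap_le _ _).trans ?_
  rw [Finset.prod_const, Finset.card_univ, Fintype.card_fin, norm_iteratedFDeriv_eq_norm_iteratedDeriv]
  calc _ ≤ 1 * ‖l‖ ^ m := mul_le_mul_of_nonneg_right (Real.abs_iteratedDeriv_sin_le_one m _) (by positivity)
    _ ≤ _ := by rw [one_mul]; exact pow_le_pow_left₀ (norm_nonneg _) hl m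

/-- The derivatives of order `m` of the sine kernels grow at most like the power `m` of the
weight. -/
theorem exists_norm_iteratedFDeriv_sineKernel_le (m : ℕ) :
    ∃ C : ℝ, ∀ (k : ι → TwiceSpin) (φ : ι → ℝ),
      ‖iteratedFDeriv ℝ m (sineKernel k) φ‖ ≤ C * spinWeight k ^ m := by
  classical
  refine ⟨∑ p ∈ (Finset.univ : Finset ι).sym m, ((p : Multiset ι).countPerms : ℝ), fun k φ => ?_⟩
  unfold sineKernel
  refine (norm_iteratedFDeriv_prod_le (N := ∞) (fun e _ => contDiff_sineFactor (k e) e)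
    (by exact_mod_cast le_top)).trans ?_
  rw [Finset.sum_mul]
  refine Finset.sum_le_sum fun p _ => mul_le_mul_of_nonneg_left ?_ (by positivity)
  rw [spinWeight, ← Finset.prod_pow]
  refine Finset.prod_le_prod (fun _ _ => norm_nonneg _) fun e _ => ?_
  refine (norm_iteratedFDeriv_sineFactor_le _ _ _ _).trans ?_
  refine pow_le_pow_right₀ (one_le_spinDim _) ?_
  exact (Multiset.count_le_card _ _).trans p.2.le

theorem contDiff_sineKernel (k : ι → TwiceSpin) : ContDiff ℝ ∞ (sineKernel k) := by
  unfold sineKernel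
  exact contDiff_prod fun e _ => contDiff_sineFactor (k e) e

theorem sineKernel_update_neg [DecidableEq ι] (k : ι → TwiceSpin) (φ : ι → ℝ) (e : ι) :
    sineKernel k (Function.update φ e (-φ e)) = -sineKernel k φ := by
  rw [sineKernel, sineKernel, ← Finset.mul_prod_erase _ _ (Finset.mem_univ e),
    ← Finset.mul_prod_erase _ _ (Finset.mem_univ e), Function.update_self, ← neg_mul]
  congr 1
  · rw [mul_neg, Real.sin_neg, Complex.ofReal_neg]
  · refine Finset.prod_congr rfl fun e' he' => ?_
    rw [Function.update_of_ne (Finset.ne_of_mem_erase he')]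

theorem sineKernel_update_add [DecidableEq ι] (k : ι → TwiceSpin) (φ : ι → ℝ) (e : ι) :
    sineKernel k (Function.update φ e (φ e + 2 * Real.pi)) = sineKernel k φ := by
  refine Finset.prod_congr rfl fun e' _ => ?_
  by_cases h : e' = e
  · subst h
    rw [Function.update_self, mul_add, Real.sin_add_nat_mul_two_pi]
  · rw [Function.update_of_ne h]

theorem isSineTest_sineKernel [DecidableEq ι] (k : ι → TwiceSpin) : IsSineTest (sineKernel k) :=
  ⟨contDiff_sineKernel k, sineKernel_update_neg k, sineKernel_update_add k⟩

theorem isSineTest_sineSeries [DecidableEq ι] {a : (ι → TwiceSpin) → ℂ} (ha : RapidDecay a) :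
    IsSineTest (sineSeries a) where
  smooth := by
    choose C hC using exists_norm_iteratedFDeriv_sineKernel_le (ι := ι)
    refine contDiff_tsum (N := ⊤) (v := fun m k => C m * (‖a k‖ * spinWeight k ^ m))
      (fun k => contDiff_const.mul (contDiff_sineKernel k)) (fun m _ => (ha.summable m).mul_left _)
      fun m k φ _ => ?_
    have h : (fun φ => a k * sineKernel k φ) = a k • sineKernel k := rfl
    rw [h, iteratedFDeriv_const_smul_apply
      ((contDiff_sineKernel k).of_le (by exact_mod_cast le_top)).contDiffAt, norm_smul]
    calc _ ≤ ‖a k‖ * (C m * spinWeight k ^ m) := mul_le_mul_of_nonneg_left (hC m k φ) (norm_nonneg _)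
      _ = _ := by ring
  odd φ e := by
    simp only [sineSeries, sineKernel_update_neg, mul_neg, tsum_neg]
  periodic φ e := by
    simp only [sineSeries, sineKernel_update_add]

end SineSeries

/-! ### Decay of the sine coefficients of test functions -/

section SineCoefficients

variable {ι : Type*} [Fintype ι]

/-- The box `[0, π]^ι` of class angles. -/
abbrev angleBox (ι : Type*) : Set (ι → ℝ) := Set.univ.pi fun _ : ι => Set.Icc 0 Real.pi

omit [Fintype ι] in
theorem isCompact_angleBox : IsCompact (angleBox ι) := isCompact_univ_pi fun _ => isCompact_Icc

theorem integrable_angleBox {V : Type*} [NormedAddCommGroup V] {f : (ι → ℝ) → V}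
    (hf : Continuous f) : Integrable f (volume.restrict (angleBox ι)) :=
  hf.continuousOn.integrableOn_compact isCompact_angleBox

variable [DecidableEq ι]

/-- The partial derivative of `h` in the direction of the coordinate `e`. -/
noncomputable def partialDeriv (e : ι) (h : (ι → ℝ) → ℂ) (φ : ι → ℝ) : ℂ :=
  fderiv ℝ h φ (Pi.single e 1)

theorem ContDiff.partialDeriv {h : (ι → ℝ) → ℂ} (hh : ContDiff ℝ ∞ h) (e : ι) :
    ContDiff ℝ ∞ (partialDeriv e h) :=
  (hh.fderiv_right (m := ∞) le_rfl).clm_apply contDiff_const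

theorem hasDerivAt_comp_update {h : (ι → ℝ) → ℂ} (hh : ContDiff ℝ ∞ h) (e : ι) (x : ι → ℝ) (t : ℝ) :
    HasDerivAt (fun t => h (Function.update x e t)) (partialDeriv e h (Function.update x e t)) t :=
  ((hh.differentiable (by simp)).differentiableAt.hasFDerivAt).comp_hasDerivAt t
    (hasDerivAt_update x e t)

/-- A symmetry `σ` of `h` that scales the coordinate direction `e` by `s` is a symmetry of the
partial derivative. -/
theorem partialDeriv_symmetry {h : (ι → ℝ) → ℂ} (hh : ContDiff ℝ ∞ h) (e : ι)
    {σ : (ι → ℝ) → ι → ℝ} {c : ℂ} {s : ℝ} (hσ : ∀ φ, h (σ φ) = c * h φ)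
    (hs : ∀ φ (t : ℝ), σ φ + t • Pi.single e (1 : ℝ) = σ (φ + t • s • Pi.single e (1 : ℝ)))
    (φ : ι → ℝ) : partialDeriv e h (σ φ) = s * c * partialDeriv e h φ := by
  have hd : Differentiable ℝ h := hh.differentiable (by simp)
  rw [partialDeriv, partialDeriv, ← (hd _).lineDeriv_eq_fderiv, lineDeriv]
  simp only [hs, hσ]
  rw [deriv_const_mul_field]
  change c * lineDeriv ℝ h φ (s • Pi.single e 1) = _
  rw [lineDeriv_smul, (hd φ).lineDeriv_eq_fderiv, Complex.real_smul]
  ring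

theorem IsSineTest.partialDeriv_partialDeriv {h : (ι → ℝ) → ℂ} (hh : IsSineTest h) (e : ι) :
    IsSineTest (partialDeriv e (partialDeriv e h)) where
  smooth := (hh.smooth.partialDeriv e).partialDeriv e
  odd φ e' := by
    have hs : ∀ (φ : ι → ℝ) (t : ℝ), Function.update φ e' (-φ e') + t • Pi.single e (1 : ℝ) =
        Function.update (φ + t • (if e' = e then (-1 : ℝ) else 1) • Pi.single e (1 : ℝ)) e'
          (-(φ + t • (if e' = e then (-1 : ℝ) else 1) • Pi.single e (1 : ℝ) : ι → ℝ) e') := by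
      intro φ t
      ext i
      by_cases h1 : i = e'
      · subst h1
        by_cases h2 : i = e
        · subst h2; simp; ring
        · simp [h2]
      · by_cases h2 : e' = e
        · subst h2; simp [h1]
        · simp [h1, h2]
    have h1 := partialDeriv_symmetry hh.smooth e (σ := fun φ => Function.update φ e' (-φ e'))
      (c := -1) (fun φ => by rw [hh.odd, neg_one_mul]) hs
    have h2 := partialDeriv_symmetry (hh.smooth.partialDeriv e) e
      (σ := fun φ => Function.update φ e' (-φ e')) h1 hs φ
    rw [h2]
    split_ifs <;> simp
  periodic φ e' := by
    have hs : ∀ (φ : ι → ℝ) (t : ℝ),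
        Function.update φ e' (φ e' + 2 * Real.pi) + t • Pi.single e (1 : ℝ) =
        Function.update (φ + t • (1 : ℝ) • Pi.single e (1 : ℝ)) e'
          ((φ + t • (1 : ℝ) • Pi.single e (1 : ℝ) : ι → ℝ) e' + 2 * Real.pi) := by
      intro φ t
      ext i
      by_cases h1 : i = e'
      · subst h1; simp; ring
      · simp [h1]
    have h1 := partialDeriv_symmetry hh.smooth e
      (σ := fun φ => Function.update φ e' (φ e' + 2 * Real.pi))
      (c := 1) (fun φ => by rw [hh.periodic, one_mul]) hs
    have h2 := partialDeriv_symmetry (hh.smooth.partialDeriv e) e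
      (σ := fun φ => Function.update φ e' (φ e' + 2 * Real.pi)) h1 hs φ
    rw [h2]
    simp

theorem IsSineTest.update_zero_eq_zero {h : (ι → ℝ) → ℂ} (hh : IsSineTest h) (e : ι) (x : ι → ℝ) :
    h (Function.update x e 0) = 0 := by
  have := hh.odd (Function.update x e 0) e
  simp at this
  exact self_eq_neg.1 this

theorem IsSineTest.update_pi_eq_zero {h : (ι → ℝ) → ℂ} (hh : IsSineTest h) (e : ι) (x : ι → ℝ) :
    h (Function.update x e Real.pi) = 0 := by
  have h1 := hh.odd (Function.update x e (-Real.pi)) e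
  have h2 := hh.periodic (Function.update x e (-Real.pi)) e
  simp at h1 h2
  rw [show -Real.pi + 2 * Real.pi = Real.pi by ring] at h2
  rw [h2] at h1
  rw [h2]
  exact self_eq_neg.1 h1

/-- Twofold integration by parts in one angle; the boundary terms vanish. -/
theorem IsSineTest.integral_update_eq_zero {h : (ι → ℝ) → ℂ} (hh : IsSineTest h) (e : ι)
    (x : ι → ℝ) (n : TwiceSpin) :
    ∫ t in Set.Icc 0 Real.pi, (partialDeriv e (partialDeriv e h) (Function.update x e t) +
      (spinDim n : ℂ) ^ 2 * h (Function.update x e t)) * (Real.sin ((spinDim n : ℝ) * t) : ℂ) = 0 := by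
  have hlin : ∀ t : ℝ, HasDerivAt (fun t : ℝ => (spinDim n : ℝ) * t) (spinDim n : ℝ) t := fun t => by
    simpa using (hasDerivAt_id t).const_mul (spinDim n : ℝ)
  have hd : ∀ t ∈ Set.uIcc 0 Real.pi, HasDerivAt
      (fun t => partialDeriv e h (Function.update x e t) * (Real.sin ((spinDim n : ℝ) * t) : ℂ) -
        (spinDim n : ℂ) * (h (Function.update x e t) * (Real.cos ((spinDim n : ℝ) * t) : ℂ)))
      ((partialDeriv e (partialDeriv e h) (Function.update x e t) +
        (spinDim n : ℂ) ^ 2 * h (Function.update x e t)) * (Real.sin ((spinDim n : ℝ) * t) : ℂ))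
      t := fun t _ => by
    have h1 := hasDerivAt_comp_update hh.smooth e x t
    have h2 := hasDerivAt_comp_update (hh.smooth.partialDeriv e) e x t
    have h3 := (((Real.hasDerivAt_sin _).comp t (hlin t)).ofReal_comp)
    have h4 := (((Real.hasDerivAt_cos _).comp t (hlin t)).ofReal_comp)
    refine ((h2.fun_mul h3).fun_sub ((h1.fun_mul h4).const_mul (spinDim n : ℂ))).congr_deriv ?_
    simp only [Function.comp]
    push_cast
    ring
  have hcu : Continuous fun t : ℝ => Function.update x e t := continuous_const.update e continuous_id
  have hc : Continuous fun t => (partialDeriv e (partialDeriv e h) (Function.update x e t) +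
      (spinDim n : ℂ) ^ 2 * h (Function.update x e t)) * (Real.sin ((spinDim n : ℝ) * t) : ℂ) := by
    have h1 := (hh.partialDeriv_partialDeriv e).smooth.continuous
    have h2 := hh.smooth.continuous
    fun_prop
  rw [integral_Icc_eq_integral_Ioc, ← intervalIntegral.integral_of_le Real.pi_pos.le,
    intervalIntegral.integral_eq_sub_of_hasDerivAt hd (hc.intervalIntegrable _ _)]
  rw [hh.update_pi_eq_zero, hh.update_zero_eq_zero, Real.sin_nat_mul_pi]
  simp

/-- Integration over a product, one coordinate first. The dummy value of that coordinate is
distributed according to a Dirac mass. -/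
theorem map_update_pi_prod (ν : Measure ℝ) [SigmaFinite ν] (e : ι) :
    ((Measure.pi (Function.update (fun _ : ι => ν) e (Measure.dirac 0))).prod ν).map
      (fun p => Function.update p.1 e p.2) = Measure.pi fun _ => ν := by
  have hsf : ∀ i, SigmaFinite (Function.update (fun _ : ι => ν) e (Measure.dirac 0) i) := fun i => by
    by_cases h : i = e
    · subst h; rw [Function.update_self]; infer_instance
    · rw [Function.update_of_ne h]; infer_instance
  have hm : Measurable fun p : (ι → ℝ) × ℝ => Function.update p.1 e p.2 :=
    (continuous_fst.update e continuous_snd).measurable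
  refine (Measure.pi_eq fun s hs => ?_).symm
  have hpre : (fun p : (ι → ℝ) × ℝ => Function.update p.1 e p.2) ⁻¹' Set.univ.pi s =
      (Set.univ.pi (Function.update s e Set.univ)) ×ˢ s e := by
    ext p
    simp only [Set.mem_preimage, Set.mem_univ_pi, Set.mem_prod]
    constructor
    · refine fun h => ⟨fun i => ?_, by simpa using h e⟩
      by_cases hi : i = e
      · subst hi; simp
      · simpa [hi] using h i
    · rintro ⟨h1, h2⟩ i
      by_cases hi : i = e
      · subst hi; simpa using h2
      · simpa [hi] using h1 i
  rw [Measure.map_apply hm (MeasurableSet.univ_pi hs), hpre, Measure.prod_prod, Measure.pi_pi,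
    ← Finset.mul_prod_erase _ _ (Finset.mem_univ e),
    ← Finset.mul_prod_erase _ (fun i => ν (s i)) (Finset.mem_univ e), Function.update_self,
    Function.update_self, measure_univ, one_mul, mul_comm]
  congr 1
  refine Finset.prod_congr rfl fun i hi => ?_
  rw [Function.update_of_ne (Finset.ne_of_mem_erase hi),
    Function.update_of_ne (Finset.ne_of_mem_erase hi)]

theorem integral_angleBox_eq_zero {f : (ι → ℝ) → ℂ} (hf : Continuous f) (e : ι)
    (h : ∀ x, ∫ t in Set.Icc 0 Real.pi, f (Function.update x e t) = 0) :
    ∫ φ in angleBox ι, f φ = 0 := by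
  have hc : Continuous fun p : (ι → ℝ) × ℝ => Function.update p.1 e p.2 :=
    continuous_fst.update e continuous_snd
  have hsf : ∀ i, SigmaFinite (Function.update
      (fun _ : ι => (volume : Measure ℝ).restrict (Set.Icc 0 Real.pi)) e (Measure.dirac 0) i) :=
    fun i => by
      by_cases h : i = e
      · subst h; rw [Function.update_self]; infer_instance
      · rw [Function.update_of_ne h]; infer_instance
  have hint := integrable_angleBox hf
  rw [volume_pi, Measure.restrict_pi_pi, ← map_update_pi_prod _ e] at hint ⊢
  rw [integrable_map_measure hf.aestronglyMeasurable hc.aemeasurable] at hint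
  rw [integral_map hc.aemeasurable hf.aestronglyMeasurable]
  refine (integral_prod _ hint).trans ?_
  simp [h]

/-- The second derivative in the angle `e` multiplies the sine coefficients by `-d_{k_e}²`. -/
theorem IsSineTest.integral_partialDeriv_partialDeriv {h : (ι → ℝ) → ℂ} (hh : IsSineTest h) (e : ι)
    (k : ι → TwiceSpin) :
    ∫ φ in angleBox ι, partialDeriv e (partialDeriv e h) φ * sineKernel k φ =
      -((spinDim (k e) : ℂ) ^ 2 * ∫ φ in angleBox ι, h φ * sineKernel k φ) := by
  have h1 := (hh.partialDeriv_partialDeriv e).smooth.continuous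
  have h2 := hh.smooth.continuous
  have h3 := continuous_sineKernel k
  have key : ∫ φ in angleBox ι, (partialDeriv e (partialDeriv e h) φ * sineKernel k φ +
      (spinDim (k e) : ℂ) ^ 2 * (h φ * sineKernel k φ)) = 0 := by
    refine integral_angleBox_eq_zero (by fun_prop) e fun x => ?_
    rw [← zero_mul (∏ i ∈ Finset.univ.erase e, (Real.sin ((spinDim (k i) : ℝ) * x i) : ℂ)),
      ← hh.integral_update_eq_zero e x (k e), ← integral_mul_const]
    congr 1
    funext t
    have hk : sineKernel k (Function.update x e t) = (Real.sin ((spinDim (k e) : ℝ) * t) : ℂ) *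
        ∏ i ∈ Finset.univ.erase e, (Real.sin ((spinDim (k i) : ℝ) * x i) : ℂ) := by
      rw [sineKernel, ← Finset.mul_prod_erase _ _ (Finset.mem_univ e), Function.update_self]
      congr 1
      refine Finset.prod_congr rfl fun i hi => ?_
      rw [Function.update_of_ne (Finset.ne_of_mem_erase hi)]
    rw [hk]
    ring
  rw [integral_add (integrable_angleBox (by fun_prop)) (integrable_angleBox (by fun_prop)),
    integral_const_mul] at key
  exact eq_neg_of_add_eq_zero_left key

/-- Applying `∏_e ∂_e²` repeatedly gains every power of the weight. -/
theorem IsSineTest.exists_norm_integral_eq {h : (ι → ℝ) → ℂ} (hh : IsSineTest h) (N : ℕ) :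
    ∃ h', IsSineTest h' ∧ ∀ k, ‖∫ φ in angleBox ι, h' φ * sineKernel k φ‖ =
      ‖∫ φ in angleBox ι, h φ * sineKernel k φ‖ * (spinWeight k ^ 2) ^ N := by
  induction N with
  | zero => exact ⟨h, hh, fun k => by simp⟩
  | succ N ih =>
    obtain ⟨h₁, hh₁, ih⟩ := ih
    have hs : ∀ s : Finset ι, ∃ h', IsSineTest h' ∧ ∀ k,
        ‖∫ φ in angleBox ι, h' φ * sineKernel k φ‖ =
          ‖∫ φ in angleBox ι, h₁ φ * sineKernel k φ‖ * (∏ e ∈ s, (spinDim (k e) : ℝ)) ^ 2 := by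
      intro s
      induction s using Finset.induction_on with
      | empty => exact ⟨h₁, hh₁, fun k => by simp⟩
      | insert e s hes ihs =>
        obtain ⟨h₂, hh₂, ihs⟩ := ihs
        refine ⟨_, hh₂.partialDeriv_partialDeriv e, fun k => ?_⟩
        rw [hh₂.integral_partialDeriv_partialDeriv, norm_neg, norm_mul, ihs,
          Finset.prod_insert hes]
        simp
        ring
    obtain ⟨h', hh', hs⟩ := hs Finset.univ
    refine ⟨h', hh', fun k => ?_⟩
    rw [hs, ih, pow_succ, spinWeight]
    ring

/-- The sine coefficients of `h` on `[0, π]^ι`. -/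
noncomputable def sineCoeff (h : (ι → ℝ) → ℂ) (k : ι → TwiceSpin) : ℂ :=
  (2 / Real.pi : ℂ) ^ Fintype.card ι * ∫ φ in angleBox ι, h φ * sineKernel k φ

theorem IsSineTest.rapidDecay_sineCoeff {h : (ι → ℝ) → ℂ} (hh : IsSineTest h) :
    RapidDecay (sineCoeff h) := by
  intro N
  obtain ⟨h', hh', hN⟩ := hh.exists_norm_integral_eq N
  obtain ⟨C, hC⟩ := isCompact_angleBox.exists_bound_of_continuousOn hh'.smooth.continuous.continuousOn
  refine ⟨‖(2 / Real.pi : ℂ) ^ Fintype.card ι‖ * (C * volume.real (angleBox ι)), fun k => ?_⟩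
  rw [sineCoeff, norm_mul, mul_assoc]
  refine mul_le_mul_of_nonneg_left ?_ (norm_nonneg _)
  have h1 := one_le_spinWeight k
  calc _ ≤ ‖∫ φ in angleBox ι, h φ * sineKernel k φ‖ * (spinWeight k ^ 2) ^ N := by
        refine mul_le_mul_of_nonneg_left ?_ (norm_nonneg _)
        exact pow_le_pow_left₀ (by positivity) (by nlinarith) N
    _ = ‖∫ φ in angleBox ι, h' φ * sineKernel k φ‖ := (hN k).symm
    _ ≤ _ := by
        refine norm_setIntegral_le_of_norm_le_const isCompact_angleBox.measure_lt_top fun φ hφ => ?_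
        rw [norm_mul]
        exact (mul_le_of_le_one_right (norm_nonneg _) (norm_sineKernel_le k φ)).trans (hC φ hφ)

end SineCoefficients

/-! ### Completeness of the sine kernels -/

section SineCompleteness

variable {ι : Type*} [Fintype ι]

theorem integral_sin_mul_sin (m n : TwiceSpin) :
    ∫ t in Set.Icc 0 Real.pi, Real.sin ((spinDim m : ℝ) * t) * Real.sin ((spinDim n : ℝ) * t) =
      if m = n then Real.pi / 2 else 0 := by
  have hcos : ∀ z : ℤ, ∫ t in (0 : ℝ)..Real.pi, Real.cos ((z : ℝ) * t) =
      if z = 0 then Real.pi else 0 := by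
    intro z
    split_ifs with hz
    · simp [hz]
    · have hz' : (z : ℝ) ≠ 0 := by exact_mod_cast hz
      rw [intervalIntegral.integral_comp_mul_left (fun t => Real.cos t) hz', integral_cos,
        Real.sin_int_mul_pi]
      simp
  have hprod : ∀ t : ℝ, Real.sin ((spinDim m : ℝ) * t) * Real.sin ((spinDim n : ℝ) * t) =
      (1 / 2) * (Real.cos ((((m : ℤ) - n : ℤ) : ℝ) * t) -
        Real.cos ((((m : ℤ) + n + 2 : ℤ) : ℝ) * t)) := fun t => by
    have h1 := Real.cos_sub ((spinDim m : ℝ) * t) ((spinDim n : ℝ) * t)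
    have h2 := Real.cos_add ((spinDim m : ℝ) * t) ((spinDim n : ℝ) * t)
    have e1 : (((m : ℤ) - n : ℤ) : ℝ) * t = (spinDim m : ℝ) * t - (spinDim n : ℝ) * t := by
      simp [spinDim]; ring
    have e2 : (((m : ℤ) + n + 2 : ℤ) : ℝ) * t = (spinDim m : ℝ) * t + (spinDim n : ℝ) * t := by
      simp [spinDim]; ring
    rw [e1, e2, h1, h2]
    ring
  simp only [hprod]
  rw [integral_Icc_eq_integral_Ioc, ← intervalIntegral.integral_of_le Real.pi_pos.le,
    intervalIntegral.integral_const_mul, intervalIntegral.integral_sub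
      (Continuous.intervalIntegrable (by fun_prop) _ _)
      (Continuous.intervalIntegrable (by fun_prop) _ _), hcos, hcos,
    if_neg (by positivity : (m : ℤ) + n + 2 ≠ 0)]
  by_cases h : m = n
  · rw [if_pos (by rw [h, sub_self]), if_pos h]; ring
  · rw [if_neg fun hz => h (by exact_mod_cast sub_eq_zero.1 hz), if_neg h]; ring

theorem integral_sineKernel_mul_sineKernel [DecidableEq ι] (j k : ι → TwiceSpin) :
    ∫ φ in angleBox ι, sineKernel j φ * sineKernel k φ =
      if j = k then (Real.pi / 2 : ℂ) ^ Fintype.card ι else 0 := by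
  have h : ∀ φ : ι → ℝ, sineKernel j φ * sineKernel k φ = ∏ e,
      ((Real.sin ((spinDim (j e) : ℝ) * φ e) * Real.sin ((spinDim (k e) : ℝ) * φ e) : ℝ) : ℂ) :=
    fun φ => by
      rw [sineKernel, sineKernel, ← Finset.prod_mul_distrib]
      refine Finset.prod_congr rfl fun e _ => by rw [Complex.ofReal_mul]
  simp only [h]
  rw [volume_pi, Measure.restrict_pi_pi, integral_fintype_prod_eq_prod (𝕜 := ℂ) fun (e : ι) (t : ℝ) =>
    ((Real.sin ((spinDim (j e) : ℝ) * t) * Real.sin ((spinDim (k e) : ℝ) * t) : ℝ) : ℂ)]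
  have h2 : ∀ e, ∫ t in Set.Icc 0 Real.pi,
      ((Real.sin ((spinDim (j e) : ℝ) * t) * Real.sin ((spinDim (k e) : ℝ) * t) : ℝ) : ℂ) =
      if j e = k e then (Real.pi / 2 : ℂ) else 0 := fun e => by
    refine (integral_ofReal (𝕜 := ℂ) (f := fun t =>
      Real.sin ((spinDim (j e) : ℝ) * t) * Real.sin ((spinDim (k e) : ℝ) * t))).trans ?_
    rw [integral_sin_mul_sin]
    split_ifs <;> simp
  simp only [h2]
  split_ifs with hjk
  · subst hjk; simp only [if_true, Finset.prod_const, Finset.card_univ]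
  · obtain ⟨e, he⟩ := Function.ne_iff.1 hjk
    exact Finset.prod_eq_zero (Finset.mem_univ e) (if_neg he)

theorem integral_sineSeries_mul_sineKernel [DecidableEq ι] {a : (ι → TwiceSpin) → ℂ}
    (ha : RapidDecay a) (k : ι → TwiceSpin) :
    ∫ φ in angleBox ι, sineSeries a φ * sineKernel k φ = a k * (Real.pi / 2 : ℂ) ^ Fintype.card ι := by
  have hint : ∀ j, Integrable (fun φ => a j * sineKernel j φ * sineKernel k φ)
      (volume.restrict (angleBox ι)) := fun j =>
    integrable_angleBox ((continuous_const.mul (continuous_sineKernel j)).mul (continuous_sineKernel k))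
  have hsum : Summable fun j => ∫ φ in angleBox ι, ‖a j * sineKernel j φ * sineKernel k φ‖ := by
    refine Summable.of_nonneg_of_le (fun j => integral_nonneg fun _ => norm_nonneg _) (fun j => ?_)
      (ha.summable_norm.mul_right (volume.real (angleBox ι)))
    have := norm_setIntegral_le_of_norm_le_const (μ := volume)
      (f := fun φ => ‖a j * sineKernel j φ * sineKernel k φ‖) (C := ‖a j‖)
      (isCompact_angleBox (ι := ι)).measure_lt_top fun φ _ => by
        rw [norm_norm, norm_mul, norm_mul]
        exact mul_le_of_le_one_right (by positivity) (norm_sineKernel_le k φ) |>.trans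
          (mul_le_of_le_one_right (norm_nonneg _) (norm_sineKernel_le j φ))
    exact (le_abs_self _).trans this
  have h := hasSum_integral_of_summable_integral_norm hint hsum
  simp only [tsum_mul_right] at h
  change HasSum _ (∫ φ in angleBox ι, sineSeries a φ * sineKernel k φ) at h
  rw [← h.tsum_eq, tsum_eq_single k]
  · simp only [mul_assoc]
    rw [integral_const_mul, integral_sineKernel_mul_sineKernel, if_pos rfl]
  · intro j hj
    simp only [mul_assoc]
    rw [integral_const_mul, integral_sineKernel_mul_sineKernel, if_neg hj, mul_zero]

/-- Orthogonality to all sine kernels is inherited by the product with `cos φ_e`, because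
`2 cos φ sin (d φ) = sin ((d + 1) φ) + sin ((d - 1) φ)`. -/
theorem integral_cos_mul_sineKernel_eq_zero [DecidableEq ι] {h : (ι → ℝ) → ℂ} (hh : Continuous h)
    (h0 : ∀ k, ∫ φ in angleBox ι, h φ * sineKernel k φ = 0) (e : ι) (k : ι → TwiceSpin) :
    ∫ φ in angleBox ι, (h φ * (Real.cos (φ e) : ℂ)) * sineKernel k φ = 0 := by
  have hupd : ∀ (n : TwiceSpin) (φ : ι → ℝ), sineKernel (Function.update k e n) φ =
      (Real.sin ((spinDim n : ℝ) * φ e) : ℂ) *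
        ∏ i ∈ Finset.univ.erase e, (Real.sin ((spinDim (k i) : ℝ) * φ i) : ℂ) := fun n φ => by
    rw [sineKernel, ← Finset.mul_prod_erase _ _ (Finset.mem_univ e), Function.update_self]
    congr 1
    refine Finset.prod_congr rfl fun i hi => ?_
    rw [Function.update_of_ne (Finset.ne_of_mem_erase hi)]
  have hk : ∀ φ, sineKernel k φ = (Real.sin ((spinDim (k e) : ℝ) * φ e) : ℂ) *
      ∏ i ∈ Finset.univ.erase e, (Real.sin ((spinDim (k i) : ℝ) * φ i) : ℂ) := fun φ => by
    rw [← hupd (k e), Function.update_eq_self]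
  have htrig : ∀ d x : ℝ, Real.cos x * Real.sin (d * x) =
      (1 / 2) * (Real.sin ((d + 1) * x) + Real.sin ((d - 1) * x)) := fun d x => by
    rw [add_mul, sub_mul, one_mul, Real.sin_add, Real.sin_sub]; ring
  have hi : ∀ k, Integrable (fun φ => h φ * sineKernel k φ) (volume.restrict (angleBox ι)) :=
    fun k => integrable_angleBox (hh.mul (continuous_sineKernel k))
  -- the lower neighbour of `d = 1` is the zero function
  rcases hn : k e with _ | n
  · have : ∀ φ, (h φ * (Real.cos (φ e) : ℂ)) * sineKernel k φ =
        (1 / 2) * (h φ * sineKernel (Function.update k e 1) φ) := fun φ => by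
      have h1 := htrig 1 (φ e)
      rw [sub_self, zero_mul, Real.sin_zero, add_zero] at h1
      have h2 : ((Real.cos (φ e) : ℝ) : ℂ) * (Real.sin (1 * φ e) : ℝ) =
          (1 / 2) * (Real.sin ((1 + 1) * φ e) : ℝ) := by rw [← Complex.ofReal_mul, h1]; push_cast; ring
      rw [hupd, hk, hn]
      have e1 : ((spinDim 0 : ℕ) : ℝ) = 1 := by simp [spinDim]
      have e2 : ((spinDim 1 : ℕ) : ℝ) = 1 + 1 := by norm_num [spinDim]
      rw [e1, e2]
      linear_combination (h φ *
        ∏ i ∈ Finset.univ.erase e, (Real.sin ((spinDim (k i) : ℝ) * φ i) : ℂ)) * h2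
    simp only [this]
    rw [integral_const_mul, h0, mul_zero]
  · have : ∀ φ, (h φ * (Real.cos (φ e) : ℂ)) * sineKernel k φ =
        (1 / 2) * (h φ * sineKernel (Function.update k e (n + 2)) φ +
          h φ * sineKernel (Function.update k e n) φ) := fun φ => by
      have h1 := htrig (n + 2) (φ e)
      have h2 : ((Real.cos (φ e) : ℝ) : ℂ) * (Real.sin ((n + 2) * φ e) : ℝ) =
          (1 / 2) * ((Real.sin ((n + 2 + 1) * φ e) : ℝ) + (Real.sin ((n + 2 - 1) * φ e) : ℝ)) := by
        rw [← Complex.ofReal_mul, h1]; push_cast; ring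
      rw [hupd, hupd, hk, hn]
      have e1 : ((spinDim (n + 1) : ℕ) : ℝ) = n + 2 := by simp [spinDim]; ring
      have e2 : ((spinDim (n + 2) : ℕ) : ℝ) = n + 2 + 1 := by simp [spinDim]
      have e3 : ((spinDim n : ℕ) : ℝ) = n + 2 - 1 := by simp [spinDim]; ring
      rw [e1, e2, e3]
      linear_combination (h φ *
        ∏ i ∈ Finset.univ.erase e, (Real.sin ((spinDim (k i) : ℝ) * φ i) : ℂ)) * h2
    simp only [this]
    rw [integral_const_mul, integral_add (hi _) (hi _), h0, h0, add_zero, mul_zero]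

/-- A continuous function orthogonal to all sine kernels vanishes on the box: it stays orthogonal
after multiplication with polynomials in the `cos φ_e`, which are dense by Stone-Weierstrass. -/
theorem eqOn_zero_of_integral_sineKernel_eq_zero [DecidableEq ι] {h : (ι → ℝ) → ℂ} (hh : Continuous h)
    (h0 : ∀ k, ∫ φ in angleBox ι, h φ * sineKernel k φ = 0) : Set.EqOn h 0 (angleBox ι) := by
  let X := angleBox ι
  have : CompactSpace X := isCompact_iff_compactSpace.1 isCompact_angleBox
  let c : ι → C(X, ℝ) := fun e => ⟨fun φ => Real.cos (φ.1 e),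
    Real.continuous_cos.comp ((continuous_apply e).comp continuous_subtype_val)⟩
  let A : Subalgebra ℝ C(X, ℝ) := Algebra.adjoin ℝ (Set.range c)
  have hsep : A.SeparatesPoints := by
    intro x y hxy
    obtain ⟨e, he⟩ : ∃ e, x.1 e ≠ y.1 e := by
      by_contra! hcon
      exact hxy (Subtype.ext (funext hcon))
    refine ⟨c e, ⟨c e, Algebra.subset_adjoin ⟨e, rfl⟩, rfl⟩, fun hc => he ?_⟩
    exact Real.injOn_cos (x.2 e trivial) (y.2 e trivial) hc
  -- every element of the algebra is the restriction of a function that preserves orthogonality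
  have hA : ∀ p ∈ A, ∃ P : (ι → ℝ) → ℝ, Continuous P ∧ (∀ φ : X, P φ.1 = p φ) ∧
      ∀ h : (ι → ℝ) → ℂ, Continuous h → (∀ k, ∫ φ in angleBox ι, h φ * sineKernel k φ = 0) →
        ∀ k, ∫ φ in angleBox ι, (h φ * (P φ : ℂ)) * sineKernel k φ = 0 := by
    intro p hp
    induction hp using Algebra.adjoin_induction with
    | mem p hp =>
      obtain ⟨e, rfl⟩ := hp
      exact ⟨fun φ => Real.cos (φ e), by fun_prop, fun φ => rfl, fun h hh h0 k =>
        integral_cos_mul_sineKernel_eq_zero hh h0 e k⟩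
    | algebraMap r =>
      refine ⟨fun _ => r, continuous_const, fun φ => rfl, fun h hh h0 k => ?_⟩
      simp only [mul_right_comm _ (r : ℂ)]
      rw [integral_mul_const, h0, zero_mul]
    | add p q _ _ hp hq =>
      obtain ⟨P, hPc, hPp, hP⟩ := hp
      obtain ⟨Q, hQc, hQq, hQ⟩ := hq
      refine ⟨fun φ => P φ + Q φ, hPc.add hQc, fun φ => by simp [hPp, hQq], fun h hh h0 k => ?_⟩
      have hk := continuous_sineKernel k
      simp only [Complex.ofReal_add, mul_add, add_mul]
      rw [integral_add (integrable_angleBox (by fun_prop)) (integrable_angleBox (by fun_prop)),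
        hP h hh h0, hQ h hh h0, add_zero]
    | mul p q _ _ hp hq =>
      obtain ⟨P, hPc, hPp, hP⟩ := hp
      obtain ⟨Q, hQc, hQq, hQ⟩ := hq
      refine ⟨fun φ => P φ * Q φ, hPc.mul hQc, fun φ => by simp [hPp, hQq], fun h hh h0 k => ?_⟩
      have := hQ (fun φ => h φ * (P φ : ℂ)) (by fun_prop) (hP h hh h0) k
      simpa only [Complex.ofReal_mul, ← mul_assoc] using this
  -- the kernel with all spins zero is the Weyl denominator
  have hweyl : ∀ φ : ι → ℝ, sineKernel (fun _ => 0) φ = weylDelta φ := fun φ => by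
    simp [sineKernel, weylDelta, spinDim]
  have hwc : Continuous (weylDelta : (ι → ℝ) → ℂ) := by unfold weylDelta; fun_prop
  have hhw : Continuous fun φ => h φ * weylDelta φ := hh.mul hwc
  have hg : ∀ g : (ι → ℝ) → ℝ, Continuous g →
      ∫ φ in angleBox ι, (g φ : ℂ) * (h φ * weylDelta φ) = 0 := by
    intro g hgc
    obtain ⟨C, hC⟩ := isCompact_angleBox.exists_bound_of_continuousOn hhw.continuousOn
    have hCV : 0 ≤ |C| * volume.real (angleBox ι) := by positivity
    rw [← norm_le_zero_iff]
    refine le_of_forall_pos_le_add fun ε hε => ?_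
    obtain ⟨p, hp⟩ := ContinuousMap.exists_mem_subalgebra_near_continuous_of_separatesPoints A hsep
      (fun φ : X => g φ.1) (by fun_prop) (ε / (|C| * volume.real (angleBox ι) + 1)) (by positivity)
    obtain ⟨P, hPc, hPp, hP⟩ := hA p.1 p.2
    have h1 := hP h hh h0 fun _ => 0
    simp only [hweyl] at h1
    have h2 : ∫ φ in angleBox ι, (g φ : ℂ) * (h φ * weylDelta φ) =
        ∫ φ in angleBox ι, ((g φ - P φ : ℝ) : ℂ) * (h φ * weylDelta φ) := by
      rw [← sub_zero (∫ φ in angleBox ι, (g φ : ℂ) * (h φ * weylDelta φ)), ← h1,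
        ← integral_sub (integrable_angleBox (by fun_prop)) (integrable_angleBox (by fun_prop))]
      congr 1
      funext φ
      push_cast
      ring
    rw [h2, zero_add]
    have h3 := norm_setIntegral_le_of_norm_le_const (μ := volume)
      (f := fun φ => ((g φ - P φ : ℝ) : ℂ) * (h φ * weylDelta φ))
      (C := ε / (|C| * volume.real (angleBox ι) + 1) * |C|)
      (isCompact_angleBox (ι := ι)).measure_lt_top fun φ hφ => by
        rw [norm_mul, Complex.norm_real]
        refine mul_le_mul ?_ ((hC φ hφ).trans (le_abs_self C)) (norm_nonneg _) (by positivity)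
        have := hp ⟨φ, hφ⟩
        rw [← norm_neg, neg_sub, hPp ⟨φ, hφ⟩]
        exact this.le
    refine h3.trans ?_
    rw [mul_assoc, div_mul_eq_mul_div, div_le_iff₀ (by positivity)]
    nlinarith
  have hopen : IsOpen (Set.univ.pi fun _ : ι => Set.Ioo 0 Real.pi) :=
    isOpen_set_pi Set.finite_univ fun _ _ => isOpen_Ioo
  have hsub : (Set.univ.pi fun _ : ι => Set.Ioo 0 Real.pi) ⊆ angleBox ι :=
    Set.pi_mono fun _ _ => Set.Ioo_subset_Icc_self
  have hae : ∀ᵐ φ ∂volume, φ ∈ (Set.univ.pi fun _ : ι => Set.Ioo 0 Real.pi) →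
      h φ * weylDelta φ = 0 := by
    refine hopen.ae_eq_zero_of_integral_contDiff_smul_eq_zero
      (hhw.locallyIntegrable.locallyIntegrableOn _) fun g hg1 _ hg3 => ?_
    rw [← hg g hg1.continuous]
    simp only [Complex.real_smul]
    refine (setIntegral_eq_integral_of_forall_compl_eq_zero fun φ hφ => ?_).symm
    rw [image_eq_zero_of_notMem_tsupport fun hmem => hφ (hsub (hg3 hmem)), Complex.ofReal_zero,
      zero_mul]
  have heq : Set.EqOn (fun φ => h φ * weylDelta φ) 0 (Set.univ.pi fun _ : ι => Set.Ioo 0 Real.pi) :=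
    Measure.eqOn_open_of_ae_eq ((ae_restrict_iff' hopen.measurableSet).2 hae) hopen
      hhw.continuousOn continuousOn_const
  have heq2 : Set.EqOn h 0 (Set.univ.pi fun _ : ι => Set.Ioo 0 Real.pi) := fun φ hφ => by
    refine (mul_eq_zero.1 (heq hφ)).resolve_right (Finset.prod_ne_zero_iff.2 fun e _ => ?_)
    have := hφ e trivial
    exact_mod_cast (Real.sin_pos_of_pos_of_lt_pi this.1 this.2).ne'
  have := heq2.closure hh continuous_const
  rwa [closure_pi_set, closure_Ioo Real.pi_pos.ne] at this

/-- A test function is the sum of its sine series. -/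
theorem IsSineTest.sineSeries_sineCoeff [DecidableEq ι] {h : (ι → ℝ) → ℂ} (hh : IsSineTest h)
    {φ : ι → ℝ} (hφ : φ ∈ angleBox ι) : sineSeries (sineCoeff h) φ = h φ := by
  have ha := hh.rapidDecay_sineCoeff
  have hc1 := (isSineTest_sineSeries ha).smooth.continuous
  have hc2 := hh.smooth.continuous
  have := eqOn_zero_of_integral_sineKernel_eq_zero (h := fun φ => sineSeries (sineCoeff h) φ - h φ)
    (hc1.sub hc2) (fun k => by
      have hk := continuous_sineKernel k
      simp only [sub_mul]
      rw [integral_sub (integrable_angleBox (by fun_prop)) (integrable_angleBox (by fun_prop)),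
        integral_sineSeries_mul_sineKernel ha, sineCoeff, mul_right_comm, ← mul_pow]
      have hpi : (2 / Real.pi : ℂ) * (Real.pi / 2) = 1 := by
        have : (Real.pi : ℂ) ≠ 0 := by exact_mod_cast Real.pi_pos.ne'
        field_simp
      rw [hpi, one_pow, one_mul, sub_self]) hφ
  exact sub_eq_zero.1 this

end SineCompleteness

/-! ### Interchange of summation -/

section Interchange

variable {ι : Type*} [Fintype ι]

theorem summable_lp_one_mul {κ : Type*} (x : lp (fun _ : κ => ℂ) 1) {b : κ → ℂ} {M : ℝ}
    (hb : ∀ k, ‖b k‖ ≤ M) : Summable fun k => x k * b k := by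
  have hx : Summable fun k => ‖x k‖ := by
    have := (lp.memℓp x).summable (by simp)
    simpa using this
  refine Summable.of_norm_bounded (hx.mul_right M) fun k => ?_
  rw [norm_mul]
  exact mul_le_mul_of_nonneg_left (hb k) (norm_nonneg _)

/-- The functional on `ℓ¹` given by a bounded family. -/
noncomputable def lpOneFunctional {κ : Type*} (b : κ → ℂ) (M : ℝ) (hb : ∀ k, ‖b k‖ ≤ M) :
    lp (fun _ : κ => ℂ) 1 →L[ℂ] ℂ :=
  LinearMap.mkContinuous
    { toFun := fun x => ∑' k, x k * b k
      map_add' := fun x y => by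
        simp only [lp.coeFn_add, Pi.add_apply, add_mul]
        exact (summable_lp_one_mul x hb).tsum_add (summable_lp_one_mul y hb)
      map_smul' := fun c x => by
        simp only [lp.coeFn_smul, Pi.smul_apply, smul_eq_mul, mul_assoc, tsum_mul_left,
          RingHom.id_apply] } M fun x => by
    have hx : Summable fun k => ‖x k‖ := by
      have := (lp.memℓp x).summable (by simp)
      simpa using this
    have hnorm : ‖x‖ = ∑' k, ‖x k‖ := by
      rw [lp.norm_eq_tsum_rpow (by simp)]
      simp
    rw [hnorm, ← tsum_mul_left]
    refine tsum_of_norm_bounded (hx.mul_left M).hasSum fun k => ?_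
    rw [norm_mul, mul_comm]
    exact mul_le_mul_of_nonneg_right (hb k) (norm_nonneg _)

theorem lpOneFunctional_apply {κ : Type*} (b : κ → ℂ) (M : ℝ) (hb : ∀ k, ‖b k‖ ≤ M)
    (x : lp (fun _ : κ => ℂ) 1) : lpOneFunctional b M hb x = ∑' k, x k * b k := rfl

theorem rapidDecay_single [DecidableEq ι] (k : ι → TwiceSpin) : RapidDecay (Pi.single k (1 : ℂ)) := by
  intro N
  refine ⟨spinWeight k ^ N, fun j => ?_⟩
  have h0 := spinWeight_pos k
  by_cases hj : j = k
  · subst hj; simp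
  · simp [hj]; positivity

theorem RapidDecay.summable_mul {a b : (ι → TwiceSpin) → ℂ} (ha : RapidDecay a) {C : ℝ}
    (hb : ∀ k, ‖b k‖ ≤ C * spinWeight k) : Summable fun k => a k * b k := by
  refine Summable.of_norm_bounded ((ha.summable 1).mul_left C) fun k => ?_
  rw [norm_mul, pow_one, mul_left_comm]
  exact mul_le_mul_of_nonneg_left (hb k) (norm_nonneg _)

/-- If the pairings with all rapidly decaying `a` are summable over `J`, the finite partial sums
are bounded by the uniform boundedness principle, after multiplication by any rapidly decaying
weight `w`. Every `ℓ¹` multiple of `w` is rapidly decaying, so the principle is applied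
on `ℓ¹`. -/
theorem RapidDecay.exists_bound_partial_sum {J : Type*} {t : J → (ι → TwiceSpin) → ℂ}
    (hb : ∀ j, ∃ C, ∀ k, ‖t j k‖ ≤ C * spinWeight k)
    (hs : ∀ a, RapidDecay a → Summable fun j => ∑' k, a k * t j k)
    {w : (ι → TwiceSpin) → ℂ} (hw : RapidDecay w) :
    ∃ C, ∀ (u : Finset J) k, ‖w k * ∑ j ∈ u, t j k‖ ≤ C := by
  classical
  choose C hC using hb
  obtain ⟨B, hB⟩ := hw 1
  have hbd : ∀ j k, ‖w k * t j k‖ ≤ |C j| * B := fun j k => by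
    have h1 := hB k
    rw [pow_one] at h1
    rw [norm_mul]
    calc _ ≤ ‖w k‖ * (|C j| * spinWeight k) := by
          refine mul_le_mul_of_nonneg_left ((hC j k).trans ?_) (norm_nonneg _)
          exact mul_le_mul_of_nonneg_right (le_abs_self _) (spinWeight_pos k).le
      _ = |C j| * (‖w k‖ * spinWeight k) := by ring
      _ ≤ _ := mul_le_mul_of_nonneg_left h1 (abs_nonneg _)
  have hbu : ∀ (u : Finset J) k, ‖w k * ∑ j ∈ u, t j k‖ ≤ ∑ j ∈ u, |C j| * B := fun u k => by
    rw [Finset.mul_sum]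
    exact norm_sum_le_of_le _ fun j _ => hbd j k
  let T : Finset J → lp (fun _ : ι → TwiceSpin => ℂ) 1 →L[ℂ] ℂ := fun u =>
    lpOneFunctional (fun k => w k * ∑ j ∈ u, t j k) _ (hbu u)
  have hpt : ∀ x, ∃ c, ∀ u, ‖T u x‖ ≤ c := fun x => by
    have hxw : RapidDecay fun k => x k * w k := fun N => by
      obtain ⟨D, hD⟩ := hw N
      refine ⟨‖x‖ * D, fun k => ?_⟩
      rw [norm_mul, mul_assoc]
      exact mul_le_mul (lp.norm_apply_le_norm one_ne_zero x k) (hD k)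
        (mul_nonneg (norm_nonneg _) (pow_nonneg (spinWeight_pos k).le N)) (norm_nonneg _)
    have hsum := (hs _ hxw).norm
    refine ⟨∑' j, ‖∑' k, x k * w k * t j k‖, fun u => ?_⟩
    have hT : T u x = ∑ j ∈ u, ∑' k, x k * w k * t j k := by
      rw [← Summable.tsum_finsetSum fun j _ => hxw.summable_mul (hC j)]
      refine (lpOneFunctional_apply _ _ (hbu u) x).trans (tsum_congr fun k => ?_)
      rw [← Finset.mul_sum, mul_assoc]
    rw [hT]
    exact (norm_sum_le _ _).trans (hsum.sum_le_tsum _ fun _ _ => norm_nonneg _)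
  obtain ⟨c, hc⟩ := banach_steinhaus hpt
  refine ⟨c, fun u k => ?_⟩
  have h1 := (T u).le_opNorm (lp.single 1 k (1 : ℂ))
  have h2 : T u (lp.single 1 k (1 : ℂ)) = w k * ∑ j ∈ u, t j k := by
    refine (lpOneFunctional_apply _ _ (hbu u) _).trans ?_
    rw [tsum_eq_single k fun k' hk' => by rw [lp.single_apply_ne _ _ _ hk', zero_mul],
      lp.single_apply_self, one_mul]
  rw [h2, lp.norm_single (by simp), norm_one, mul_one] at h1
  exact h1.trans (hc u)

/-- Sums over `J` and over spins may be interchanged: multiplying `a` by the square of the weight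
and applying the uniform bound yields a summable majorant. -/
theorem RapidDecay.hasSum_mul_tsum {J : Type*} {t : J → (ι → TwiceSpin) → ℂ}
    (hb : ∀ j, ∃ C, ∀ k, ‖t j k‖ ≤ C * spinWeight k)
    (hs : ∀ a, RapidDecay a → Summable fun j => ∑' k, a k * t j k)
    {a : (ι → TwiceSpin) → ℂ} (ha : RapidDecay a) :
    HasSum (fun k => a k * ∑' j, t j k) (∑' j, ∑' k, a k * t j k) := by
  classical
  have hw : RapidDecay fun k => a k * (spinWeight k : ℂ) ^ 2 := fun N => by
    obtain ⟨C, hC⟩ := ha (2 + N)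
    refine ⟨C, fun k => ?_⟩
    rw [norm_mul, norm_pow, Complex.norm_real, Real.norm_of_nonneg (spinWeight_pos k).le, mul_assoc,
      ← pow_add]
    exact hC k
  obtain ⟨C, hC⟩ := hw.exists_bound_partial_sum hb hs
  have hbound : ∀ (u : Finset J) k, ‖a k * ∑ j ∈ u, t j k‖ ≤ C * (spinWeight k ^ 2)⁻¹ := fun u k => by
    have h0 := spinWeight_pos k
    have h1 := hC u k
    rw [mul_right_comm, norm_mul, norm_pow, Complex.norm_real, Real.norm_of_nonneg h0.le] at h1
    rw [← div_eq_mul_inv, le_div_iff₀ (by positivity)]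
    exact h1
  have hsk : ∀ k, Summable fun j => t j k := fun k => by
    have := hs _ (rapidDecay_single k)
    refine this.congr fun j => ?_
    rw [tsum_eq_single k fun k' hk' => by rw [Pi.single_eq_of_ne hk', zero_mul], Pi.single_eq_same,
      one_mul]
  have hlim : ∀ k, Filter.Tendsto (fun u : Finset J => a k * ∑ j ∈ u, t j k) Filter.atTop
      (nhds (a k * ∑' j, t j k)) := fun k => (hsk k).hasSum.const_mul (a k)
  have hmaj : Summable fun k : ι → TwiceSpin => C * (spinWeight k ^ 2)⁻¹ :=
    summable_inv_spinWeight_sq.mul_left C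
  have h1 := tendsto_tsum_of_dominated_convergence hmaj hlim (Filter.Eventually.of_forall hbound)
  have h2 : ∀ u : Finset J, ∑' k, a k * ∑ j ∈ u, t j k = ∑ j ∈ u, ∑' k, a k * t j k := fun u => by
    choose D hD using hb
    rw [← Summable.tsum_finsetSum fun j _ => ha.summable_mul (hD j)]
    simp only [Finset.mul_sum]
  simp only [h2] at h1
  have h3 := tendsto_nhds_unique h1 (hs a ha).hasSum
  rw [← h3]
  exact (Summable.of_norm_bounded hmaj fun k => le_of_tendsto (hlim k).norm
    (Filter.Eventually.of_forall fun u => hbound u k)).hasSum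

end Interchange

/-! ### Character series -/

section CharacterSeries

variable {ι : Type*} [Fintype ι]

/-- The product `∏_e χ_{k_e}(G_e)` of characters. -/
noncomputable def charKernel (k : ι → TwiceSpin) (G : ι → SU2) : ℂ := ∏ e, spinChar (k e) (G e)

theorem continuous_charKernel (k : ι → TwiceSpin) : Continuous (charKernel k) :=
  continuous_finsetProd _ fun e _ => (continuous_spinChar (k e)).comp (continuous_apply e)

theorem norm_charKernel_le (k : ι → TwiceSpin) (G : ι → SU2) : ‖charKernel k G‖ ≤ spinWeight k := by
  rw [charKernel, norm_prod]
  exact Finset.prod_le_prod (fun _ _ => norm_nonneg _) fun e _ => norm_spinChar_le _ _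

theorem charKernel_conjCartan_mul_weylDelta (k : ι → TwiceSpin) (x : ι → SU2) (φ : ι → ℝ) :
    charKernel k (conjCartan x φ) * weylDelta φ = sineKernel k φ := by
  rw [charKernel, weylDelta, sineKernel, ← Finset.prod_mul_distrib]
  exact Finset.prod_congr rfl fun e _ => spinChar_conj_cartan_mul_sin _ _ _

/-- The character series with coefficients `a`. -/
noncomputable def charSeries (a : (ι → TwiceSpin) → ℂ) (G : ι → SU2) : ℂ :=
  ∑' k, a k * charKernel k G

theorem norm_mul_charKernel_le (a : (ι → TwiceSpin) → ℂ) (k : ι → TwiceSpin) (G : ι → SU2) :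
    ‖a k * charKernel k G‖ ≤ ‖a k‖ * spinWeight k ^ 1 := by
  rw [norm_mul, pow_one]
  exact mul_le_mul_of_nonneg_left (norm_charKernel_le k G) (norm_nonneg _)

theorem continuous_charSeries {a : (ι → TwiceSpin) → ℂ} (ha : RapidDecay a) :
    Continuous (charSeries a) :=
  continuous_tsum (fun k => continuous_const.mul (continuous_charKernel k)) (ha.summable 1)
    fun k G => norm_mul_charKernel_le a k G

theorem charSeries_conjCartan_mul_weylDelta (a : (ι → TwiceSpin) → ℂ) (x : ι → SU2) (φ : ι → ℝ) :
    charSeries a (conjCartan x φ) * weylDelta φ = sineSeries a φ := by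
  rw [charSeries, sineSeries, ← tsum_mul_right]
  simp only [mul_assoc, charKernel_conjCartan_mul_weylDelta]

variable (μ : Measure SU2) [μ.IsHaarMeasure]

theorem isSmearedDelta_charKernel (k : ι → TwiceSpin) :
    IsSmearedDelta μ (fun φ => sineKernel k φ * weylDelta φ) (charKernel k) :=
  isSmearedDelta_of_conjCartan μ (continuous_charKernel k) fun φ _ x =>
    charKernel_conjCartan_mul_weylDelta k x φ

theorem isSmearedDelta_charSeries {a : (ι → TwiceSpin) → ℂ} (ha : RapidDecay a) {h : (ι → ℝ) → ℂ}
    (hh : Set.EqOn (sineSeries a) h (angleBox ι)) :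
    IsSmearedDelta μ (fun φ => h φ * weylDelta φ) (charSeries a) :=
  isSmearedDelta_of_conjCartan μ (continuous_charSeries ha) fun φ hφ x => by
    rw [charSeries_conjCartan_mul_weylDelta, hh hφ]

end CharacterSeries

/-! ### Expectation values -/

section Expectation

variable {E F : Type*} [Fintype E] [Fintype F]

theorem DualSkeleton.continuous_holonomy {E F : Type*} (K : DualSkeleton E F) (e : E) :
    Continuous fun g : F → SU2 => K.holonomy g e := by
  unfold DualSkeleton.holonomy
  simp only [← List.map_reverse]
  refine continuous_list_prod _ fun s _ => ?_
  split_ifs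
  · exact continuous_apply s.1
  · exact (continuous_apply s.1).inv

omit [Fintype F] in
theorem continuous_amplitude (K : DualSkeleton E F) (j : E → TwiceSpin) :
    Continuous (amplitude K j) :=
  continuous_finsetProd _ fun e _ => (continuous_spinChar (j e)).comp (K.continuous_holonomy e)

omit [Fintype F] in
theorem norm_amplitude_le (K : DualSkeleton E F) (j : E → TwiceSpin) (g : F → SU2) :
    ‖amplitude K j g‖ ≤ spinWeight j :=
  norm_charKernel_le j fun e => K.holonomy g e

variable (K : DualSkeleton E F) (Γ : Finset E) (μ : Measure SU2) [μ.IsHaarMeasure]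

omit [Fintype F] in
theorem norm_amplitude_mul_particle_le (j : E → TwiceSpin) (g : F → SU2) (z : ℂ) :
    ‖amplitude K j g * ((∏ e : Γ, if j e = 0 then 1 else 0) * z)‖ ≤ spinWeight j * ‖z‖ := by
  rw [norm_mul, norm_mul]
  refine mul_le_mul (norm_amplitude_le K j g) ?_ (by positivity) (spinWeight_pos j).le
  refine mul_le_of_le_one_left (norm_nonneg _) ?_
  rw [norm_prod]
  refine Finset.prod_le_one (fun _ _ => norm_nonneg _) fun e _ => ?_
  split_ifs <;> simp

theorem expectationTerm_particleObs_sineKernel (j : E → TwiceSpin) (k : Γ → TwiceSpin) :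
    expectationTerm μ K (particleObs μ K Γ fun φ => sineKernel k φ * weylDelta φ) j =
      (∏ e, (spinDim (j e) : ℂ) / groupVol μ) * ∫ g, amplitude K j g *
        ((∏ e : Γ, if j e = 0 then 1 else 0) * charKernel k fun e : Γ => K.holonomy g e)
          ∂(Measure.pi fun _ : F => μ) := by
  rw [expectationTerm]
  simp only [particleObs, (isSmearedDelta_charKernel μ k).smearedDelta_eq]

theorem exists_norm_expectationTerm_le (j : E → TwiceSpin) : ∃ C, ∀ k : Γ → TwiceSpin,
    ‖expectationTerm μ K (particleObs μ K Γ fun φ => sineKernel k φ * weylDelta φ) j‖ ≤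
      C * spinWeight k := by
  refine ⟨‖∏ e, (spinDim (j e) : ℂ) / groupVol μ‖ *
    (spinWeight j * (Measure.pi fun _ : F => μ).real Set.univ), fun k => ?_⟩
  rw [expectationTerm_particleObs_sineKernel, norm_mul, mul_assoc]
  refine mul_le_mul_of_nonneg_left ?_ (norm_nonneg _)
  rw [mul_right_comm]
  refine norm_integral_le_of_norm_le_const (Filter.Eventually.of_forall fun g => ?_)
  refine (norm_amplitude_mul_particle_le K Γ j g _).trans ?_
  exact mul_le_mul_of_nonneg_left (norm_charKernel_le _ _) (spinWeight_pos j).le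

/-- The summands of the expectation value of the particle observable depend on the test function
through its sine coefficients. -/
theorem expectationTerm_particleObs_eq_tsum {a : (Γ → TwiceSpin) → ℂ} (ha : RapidDecay a)
    {h : (Γ → ℝ) → ℂ} (hh : Set.EqOn (sineSeries a) h (angleBox Γ)) (j : E → TwiceSpin) :
    expectationTerm μ K (particleObs μ K Γ fun φ => h φ * weylDelta φ) j = ∑' k, a k *
      expectationTerm μ K (particleObs μ K Γ fun φ => sineKernel k φ * weylDelta φ) j := by
  have hhol : Continuous fun (g : F → SU2) (e : Γ) => K.holonomy g e :=
    continuous_pi fun e => K.continuous_holonomy e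
  simp only [expectationTerm_particleObs_sineKernel]
  rw [expectationTerm]
  simp only [particleObs, (isSmearedDelta_charSeries μ ha hh).smearedDelta_eq]
  rw [tsum_congr fun k => mul_left_comm (a k) _ _, tsum_mul_left]
  simp only [← integral_const_mul (a _)]
  congr 1
  have hint : ∀ k : Γ → TwiceSpin, Integrable (fun g => a k * (amplitude K j g *
      ((∏ e : Γ, if j e = 0 then 1 else 0) * charKernel k fun e : Γ => K.holonomy g e)))
      (Measure.pi fun _ : F => μ) := fun k =>
    integrable_pi_of_continuous μ (continuous_const.mul ((continuous_amplitude K j).mul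
      (continuous_const.mul ((continuous_charKernel k).comp hhol))))
  have hsum : Summable fun k : Γ → TwiceSpin => ∫ g, ‖a k * (amplitude K j g *
      ((∏ e : Γ, if j e = 0 then 1 else 0) * charKernel k fun e : Γ => K.holonomy g e))‖
      ∂(Measure.pi fun _ : F => μ) := by
    refine Summable.of_nonneg_of_le (fun k => integral_nonneg fun _ => norm_nonneg _) (fun k => ?_)
      ((ha.summable 1).mul_right (spinWeight j * (Measure.pi fun _ : F => μ).real Set.univ))
    have := norm_integral_le_of_norm_le_const (μ := Measure.pi fun _ : F => μ)
      (f := fun g => ‖a k * (amplitude K j g *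
        ((∏ e : Γ, if j e = 0 then 1 else 0) * charKernel k fun e : Γ => K.holonomy g e))‖)
      (C := ‖a k‖ * (spinWeight j * spinWeight k)) (Filter.Eventually.of_forall fun g => by
        rw [norm_norm, norm_mul]
        refine mul_le_mul_of_nonneg_left ?_ (norm_nonneg _)
        refine (norm_amplitude_mul_particle_le K Γ j g _).trans ?_
        exact mul_le_mul_of_nonneg_left (norm_charKernel_le _ _) (spinWeight_pos j).le)
    refine (le_abs_self _).trans (this.trans_eq ?_)
    ring
  rw [(hasSum_integral_of_summable_integral_norm hint hsum).tsum_eq]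
  congr 1
  funext g
  rw [charSeries, ← tsum_mul_left, ← tsum_mul_left]
  exact tsum_congr fun k => by ring

/-! ### The duality of length and particle observables -/

variable [DecidableEq E]

theorem prod_dite_mem_one {M : Type*} [CommMonoid M] (r : Γ → M) :
    ∏ e : E, (if h : e ∈ Γ then r ⟨e, h⟩ else 1) = ∏ e : Γ, r e := by
  rw [← Finset.prod_subset (Finset.subset_univ Γ) fun e _ he => dif_neg he, ← Finset.prod_attach,
    Finset.univ_eq_attach]
  exact Finset.prod_congr rfl fun e _ => dif_pos e.2

/-- The permutation of the spin labellings that exchanges the spins `0` and `jΓ e` at every edge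
`e` of `Γ`. It maps the support of the particle observable to that of the length observable. -/
def swapSpins (jΓ : Γ → TwiceSpin) : (E → TwiceSpin) ≃ (E → TwiceSpin) :=
  Equiv.piCongrRight fun e => if h : e ∈ Γ then Equiv.swap 0 (jΓ ⟨e, h⟩) else Equiv.refl _

omit [Fintype E] in
theorem swapSpins_apply_mem (jΓ : Γ → TwiceSpin) (j : E → TwiceSpin) (e : Γ) :
    swapSpins Γ jΓ j e = Equiv.swap 0 (jΓ e) (j e) := by
  simp [swapSpins]

omit [Fintype E] in
theorem swapSpins_apply_notMem (jΓ : Γ → TwiceSpin) (j : E → TwiceSpin) {e : E} (he : e ∉ Γ) :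
    swapSpins Γ jΓ j e = j e := by
  simp [swapSpins, he]

/-- The summands of the two expectation values agree: trading a spin `0` for the spin `jΓ e`
replaces `1` by the character of `jΓ e`, and the dimensions cancel. -/
theorem expectationTerm_lengthObs_swapSpins (jΓ : Γ → TwiceSpin) (j : E → TwiceSpin) :
    expectationTerm μ K (lengthObs F Γ jΓ) (swapSpins Γ jΓ j) =
      expectationTerm μ K (particleObs μ K Γ fun φ => sineKernel jΓ φ * weylDelta φ) j := by
  rw [expectationTerm_particleObs_sineKernel, expectationTerm]
  simp only [lengthObs]
  by_cases hj : ∀ e : Γ, j e = 0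
  · have hσ : ∀ e : Γ, swapSpins Γ jΓ j e = jΓ e := fun e => by
      rw [swapSpins_apply_mem, hj, Equiv.swap_apply_left]
    have hdim : ∏ e, (spinDim (swapSpins Γ jΓ j e) : ℂ) / groupVol μ =
        (∏ e, (spinDim (j e) : ℂ) / groupVol μ) * ∏ e : Γ, (spinDim (jΓ e) : ℂ) := by
      rw [← prod_dite_mem_one, ← Finset.prod_mul_distrib]
      refine Finset.prod_congr rfl fun e _ => ?_
      split_ifs with he
      · rw [hσ ⟨e, he⟩, hj ⟨e, he⟩]
        simp [spinDim]
        ring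
      · rw [swapSpins_apply_notMem Γ jΓ j he, mul_one]
    have hamp : ∀ g, amplitude K (swapSpins Γ jΓ j) g =
        amplitude K j g * charKernel jΓ fun e : Γ => K.holonomy g e := fun g => by
      rw [amplitude, amplitude, charKernel, ← prod_dite_mem_one, ← Finset.prod_mul_distrib]
      refine Finset.prod_congr rfl fun e _ => ?_
      split_ifs with he
      · rw [hσ ⟨e, he⟩, hj ⟨e, he⟩, spinChar_zero, one_mul]
      · rw [swapSpins_apply_notMem Γ jΓ j he, mul_one]
    have hne : (∏ e : Γ, (spinDim (jΓ e) : ℂ)) ≠ 0 :=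
      Finset.prod_ne_zero_iff.2 fun e _ => Nat.cast_ne_zero.2 (Nat.succ_ne_zero _)
    simp only [hσ, hj, if_true, Finset.prod_const_one, one_mul, hdim, hamp, Finset.prod_div_distrib]
    rw [integral_mul_const]
    field_simp
  · push Not at hj
    obtain ⟨e, he⟩ := hj
    have h1 : ∏ e : Γ, ((if swapSpins Γ jΓ j e = jΓ e then 1 else 0) / (spinDim (jΓ e) : ℂ)) = 0 := by
      refine Finset.prod_eq_zero (Finset.mem_univ e) ?_
      rw [if_neg, zero_div]
      rw [swapSpins_apply_mem, Equiv.swap_apply_eq_iff, Equiv.swap_apply_right]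
      exact he
    have h2 : ∏ e : Γ, (if j e = 0 then (1 : ℂ) else 0) = 0 :=
      Finset.prod_eq_zero (Finset.mem_univ e) (if_neg he)
    simp only [h1, h2, zero_mul, mul_zero, integral_zero]

theorem summable_lengthObs_iff (jΓ : Γ → TwiceSpin) :
    Summable (expectationTerm μ K (lengthObs F Γ jΓ)) ↔ Summable (expectationTerm μ K
      (particleObs μ K Γ fun φ => sineKernel jΓ φ * weylDelta φ)) := by
  rw [← (swapSpins Γ jΓ).summable_iff]
  exact summable_congr fun j => expectationTerm_lengthObs_swapSpins K Γ μ jΓ j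

theorem expectation_lengthObs_eq (jΓ : Γ → TwiceSpin) :
    expectation μ K (lengthObs F Γ jΓ) =
      expectation μ K (particleObs μ K Γ fun φ => sineKernel jΓ φ * weylDelta φ) := by
  rw [expectation, expectation, ← (swapSpins Γ jΓ).tsum_eq]
  exact tsum_congr fun j => expectationTerm_lengthObs_swapSpins K Γ μ jΓ j

end Expectation

theorem mainTheorem1 {E F : Type*} [Fintype E] [DecidableEq E] [Fintype F]
    (K : DualSkeleton E F) (μ : Measure SU2) [μ.IsHaarMeasure] (Γ : Finset E) :
    -- the particle observable is a well-defined distribution in the angles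
    (∀ h : (Γ → ℝ) → ℂ, IsSineTest h →
      ∃! D, IsSmearedDelta μ (fun φ => h φ * weylDelta φ) D) ∧
    -- first duality formula
    (∀ jΓ : Γ → TwiceSpin,
      (Summable (expectationTerm μ K (lengthObs F Γ jΓ)) ↔
        Summable (expectationTerm μ K
          (particleObs μ K Γ fun φ => sineKernel jΓ φ * weylDelta φ))) ∧
      expectation μ K (lengthObs F Γ jΓ) =
        expectation μ K (particleObs μ K Γ fun φ => sineKernel jΓ φ * weylDelta φ)) ∧
    -- second duality formula, whenever the expectation value of the particle observable exists
    ((∀ h : (Γ → ℝ) → ℂ, IsSineTest h →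
        Summable (expectationTerm μ K (particleObs μ K Γ fun φ => h φ * weylDelta φ))) →
      (∀ jΓ : Γ → TwiceSpin, Summable (expectationTerm μ K (lengthObs F Γ jΓ))) ∧
      ∀ h : (Γ → ℝ) → ℂ, IsSineTest h →
        HasSum
          (fun jΓ : Γ → TwiceSpin =>
            (2 / Real.pi : ℂ) ^ Γ.card *
              (∫ φ in Set.univ.pi fun _ : Γ => Set.Icc 0 Real.pi, h φ * sineKernel jΓ φ) *
              expectation μ K (lengthObs F Γ jΓ))
          (expectation μ K (particleObs μ K Γ fun φ => h φ * weylDelta φ))) := by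
  refine ⟨fun h hh => ?_, fun jΓ => ⟨summable_lengthObs_iff K Γ μ jΓ,
    expectation_lengthObs_eq K Γ μ jΓ⟩, fun hsum => ⟨fun jΓ => ?_, fun h hh => ?_⟩⟩
  · have hD := isSmearedDelta_charSeries μ hh.rapidDecay_sineCoeff fun φ hφ =>
      hh.sineSeries_sineCoeff hφ
    exact ⟨_, hD, fun D' hD' => IsSmearedDelta.unique μ hD' hD⟩
  · exact (summable_lengthObs_iff K Γ μ jΓ).2 (hsum _ (isSineTest_sineKernel jΓ))
  · have key := hh.rapidDecay_sineCoeff.hasSum_mul_tsum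
      (t := fun j k => expectationTerm μ K
        (particleObs μ K Γ fun φ => sineKernel k φ * weylDelta φ) j)
      (exists_norm_expectationTerm_le K Γ μ) fun a ha =>
        (hsum _ (isSineTest_sineSeries ha)).congr fun j =>
          expectationTerm_particleObs_eq_tsum K Γ μ ha (fun φ _ => rfl) j
    have hval : expectation μ K (particleObs μ K Γ fun φ => h φ * weylDelta φ) =
        ∑' j, ∑' k, sineCoeff h k * expectationTerm μ K
          (particleObs μ K Γ fun φ => sineKernel k φ * weylDelta φ) j :=
      tsum_congr fun j => expectationTerm_particleObs_eq_tsum K Γ μ hh.rapidDecay_sineCoeff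
        (fun φ hφ => hh.sineSeries_sineCoeff hφ) j
    rw [hval]
    refine key.congr_fun fun jΓ => ?_
    rw [expectation_lengthObs_eq, expectation, sineCoeff, Fintype.card_coe]
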